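/- **Setting.** Let $\mathcal X=\mathbb R^d$, $\mathcal Y=\mathbb R^{d_1}$, $\Gamma\subseteq\mathbb R^{d_2}$, let $N$ be the time horizon, $\mu$ a Borel probability measure on $\mathcal Y$ (the noise distribution), $\Psi:\mathbb N_0\times\mathcal X\times\Gamma\times\mathcal Y\to\mathcal X$ the system function, $f:\mathbb N_0\times\mathcal X\times\Gamma\to\mathbb R$ the running costs and $F:\mathcal X\to\mathbb R$ the terminal costs. The value function is $$V(j_0,x_0)=\inf_{u}\ \mathbf E\Big[\sum_{j=j_0}^{N-1}f(j,X_j,u(j,X_j))+F(X_N)\Big],\qquad X_{j_0}=x_0,\quad X_{j+1}=\Psi(j,X_j,u(j,X_j),\xi_{j+1}),$$ where $(\xi_j)$ are i.i.d. with law $\mu$ and the infimum is over all Borel maps $u:\mathbb N_0\times\mathcal X\to\Gamma$. For $g:\mathcal X\to\mathbb R\cup\{\infty\}$ put $$\mathcal L_j(g)(x)=\inf_{\gamma\in\Gamma}\Big\{f(j,x,\gamma)+\int_{\mathcal Y}g(\Psi(j,x,\gamma,z))\,\mu(dz)\Big\}.$$ Let $D^-g(x)$ be the set of $p\in\mathbb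 R^d$ with $g(y)\ge g(x)+p\cdot(y-x)$ for all $y$, and $\|D^-g\|_\infty=\sup_x\sup_{p\in D^-g(x)}|p|$. A subsolution is a function $w:\{0,\dots,N\}\times\mathcal X\to\mathbb R\cup\{\infty\}$ that is lower semicontinuous in $x$, bounded from below, and satisfies $w(N,\cdot)\le F$ and $w(j,\cdot)\le\mathcal L_j(w(j+1,\cdot))$ for $0\le j<N$. Let $(\Omega,\mathcal F,\mathbf P)$ be a probability space and $\nu$ a Borel probability measure on $\mathcal X$. A *controlled state sequence with initial law $\nu$* consists of a filtration $(\mathcal F_j)_{0\le j\le N}$ in $\mathcal F$, variables $\xi_j$ ($1\le j\le N$) with law $\mu$ that are $\mathcal F_j$-measurable and independent of $\mathcal F_{j-1}$, $\Gamma$-valued $\mathcal F_j$-measurable $\gamma_j$ ($0\le j<N$), an $\mathcal F_0$-measurable $X_0$ with law $\nu$, and $X_{j+1}=\Psi(j,X_j,\gamma_j,\xi_{j+1})$ for $0\le j<N$. **Assumptions.** - (A1) $\Psi$ is continuous. - (A2) $f$ and $F$ are non-negative and lower semicontinuous. - (A3) $F$ is convex and of at most linear growth, $|F(x)|\le C(1+|x|)$.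 - (A4) $\Gamma$ is compact (and nonempty). - (A5) For every $j\in\mathbb N_0$ and every convex $g:\mathcal X\to\mathbb R$ that is bounded from below and of at most linear growth, $\mathcal L_j(g)$ is a real-valued convex function. - (A6) There are constants $c_0,c_1\ge 0$ such that, for every convex $g:\mathcal X\to\mathbb R$ that is bounded from below with $\|D^-g\|_\infty<\infty$ and every $j\in\{1,\dots,N-1\}$, $\|D^-\mathcal L_j(g)\|_\infty\le c_0+c_1\|D^-g\|_\infty$. - (A7) For every family $(X^n_j,\gamma^n_j)$, $n\in\mathbb N_0$, of controlled state sequences on $(\Omega,\mathcal F,\mathbf P)$ with common initial law $\nu$ there is $p>1$ such that $$\sup_{n}\mathbf E\Big[\Big(\sum_{j=0}^{N-1}f(j,X^n_j,\gamma^n_j)+F(X^n_N)\Big)^p\Big]<\infty\quad\text{and}\quad\sup_{n}\max_{1\le j\le N}\mathbf E[|X^n_j|^p]<\infty.$$ **Algorithm.** Let $w^{(0)}$ be a subsolution with all $w^{(0)}(j,\cdot)$ convex. Given $w^{(n)}_\omega$ ($n\ge 0$), draw $X^n_0$ with law $\nu$, independently of everything that happened in the earlier iterations, and simulate a controlled state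 sequence $(X^n_j)$ with noise $\xi^n_j$, whose filtration $(\mathcal F^{(n)}_j)_j$ contains all information from the earlier iterations (including their selections of slopes), using controls $$\gamma^n_j(\omega)\in\operatorname*{argmin}_{\gamma\in\Gamma}\Big\{f(j,X^n_j(\omega),\gamma)+\int w^{(n)}_\omega(j+1,\Psi(j,X^n_j(\omega),\gamma,z))\,\mu(dz)\Big\},\qquad 0\le j<N.$$ Then, backwards in $j$, put $$w^{(n+1)}_\omega(j,x)=\max\{w^{(n)}_\omega(j,x),\ v^n_j+p^n_j\cdot(x-X^n_j(\omega))\},$$ where $v^n_N=F(X^n_N)$, $p^n_N\in D^-F(X^n_N)$ and, for $j<N$, $v^n_j=\mathcal L_j(w^{(n+1)}_\omega(j+1,\cdot))(X^n_j)$, $p^n_j\in D^-\mathcal L_j(w^{(n+1)}_\omega(j+1,\cdot))(X^n_j)$; the selected slopes $p^n_j$ are random variables that depend only on the information available at the end of iteration $n$ (before $X^{n+1}_0$ is drawn). **Theorem.** Under (A1)–(A7), for $\mathbf P$-almost every $\omega$ the functions $w^{(n)}_\omega(0,\cdot)$ are real-valued and converge, as $n\to\infty$, uniformly on compact subsets of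 $\operatorname{supp}(\nu)$ to a limit $w_\omega(0,\cdot)$, and $$w_\omega(0,x)=V(0,x)\qquad\text{for all }x\in\operatorname{supp}(\nu).$$ -/

import Mathlib

open MeasureTheory ProbabilityTheory Filter Topology
open scoped ENNReal NNReal

noncomputable section

/-- The Euclidean space `ℝⁿ`. -/
abbrev Vec (n : ℕ) : Type := EuclideanSpace ℝ (Fin n)

/-- The integral of an extended real valued function, positive part minus negative part. It has its
usual meaning as soon as `g` is measurable and bounded from below by a real constant (then the
negative part has a finite integral), which is the only case in which it is used. -/
def extIntegral {α : Type*} [MeasurableSpace α] (μ : Measure α) (g : α → EReal) : EReal :=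
  ((∫⁻ a, (g a).toENNReal ∂μ : ℝ≥0∞) : EReal) - ((∫⁻ a, (-g a).toENNReal ∂μ : ℝ≥0∞) : EReal)

/-- An extended real valued function is convex if its epigraph is a convex set. -/
def ExtConvex {n : ℕ} (g : Vec n → EReal) : Prop :=
  Convex ℝ {z : Vec n × ℝ | g z.1 ≤ (z.2 : EReal)}

/-- The hyperplane function `x ↦ v + p · (x - x̄)`. -/
def hyp {n : ℕ} (xbar : Vec n) (v : EReal) (p : Vec n) (x : Vec n) : EReal :=
  v + ((inner ℝ p (x - xbar) : ℝ) : EReal)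

/-- The subgradient `D⁻ g(x)`: all slopes of hyperplanes through `(x, g x)` that lie below `g`. -/
def subgradient {n : ℕ} (g : Vec n → EReal) (x : Vec n) : Set (Vec n) :=
  {p | ∀ y, hyp x (g x) p y ≤ g y}

/-- `‖D⁻ g‖_∞`, the supremum of the Euclidean norms of all subgradients of `g`. -/
def subgradientNorm {n : ℕ} (g : Vec n → EReal) : ℝ≥0∞ :=
  ⨆ x : Vec n, ⨆ p ∈ subgradient g x, ‖p‖ₑ

/-- A real function of at most linear growth. -/
def LinearGrowth {n : ℕ} (g : Vec n → ℝ) : Prop :=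
  ∃ C : ℝ, ∀ x, |g x| ≤ C * (1 + ‖x‖)

/-- The data of a finite horizon control problem: state space `ℝ^d`, disturbance space `ℝ^d₁`,
action space `Γ ⊆ ℝ^d₂`, system function `Ψ`, running costs `f`, terminal costs `F`, time horizon
`N`, and noise distribution `μ`. -/
structure ControlProblem (d d₁ d₂ : ℕ) where
  Γ : Set (Vec d₂)
  Ψ : ℕ → Vec d → Γ → Vec d₁ → Vec d
  f : ℕ → Vec d → Γ → ℝ
  F : Vec d → ℝ
  N : ℕ
  μ : Measure (Vec d₁)
  μ_prob : IsProbabilityMeasure μ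

namespace ControlProblem

variable {d d₁ d₂ : ℕ} (S : ControlProblem d d₁ d₂)

/-! ### The value function -/

/-- The state sequence `X_{j₀} = x₀`, `X_{j+1} = Ψ(j, X_j, u(j, X_j), y_{j+1})` for `j ≥ j₀`,
generated by the feedback policy `u` and a realization `y` of the noise (for `j < j₀` it is set to
`x₀`, which is never used). -/
def feedbackState (u : ℕ → Vec d → S.Γ) (j₀ : ℕ) (x₀ : Vec d) (y : ℕ → Vec d₁) : ℕ → Vec d
  | 0 => x₀
  | j + 1 =>
    if j₀ ≤ j then
      S.Ψ j (feedbackState u j₀ x₀ y j) (u j (feedbackState u j₀ x₀ y j)) (y (j + 1))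
    else x₀

/-- The cost functional `J(j₀, x₀, u)`, the expectation being taken on the canonical space of
independent noise variables with law `μ`. -/
def costFunctional (j₀ : ℕ) (x₀ : Vec d) (u : ℕ → Vec d → S.Γ) : EReal :=
  extIntegral (Measure.infinitePi (fun _ : ℕ => S.μ)) (fun y =>
    ((∑ j ∈ Finset.Ico j₀ S.N,
        S.f j (S.feedbackState u j₀ x₀ y j) (u j (S.feedbackState u j₀ x₀ y j))
      + S.F (S.feedbackState u j₀ x₀ y S.N) : ℝ) : EReal))

/-- The value function `V(j₀, x₀)`: the infimum of the costs over all Borel measurable Markov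
feedback control policies. -/
def valueFunction (j₀ : ℕ) (x₀ : Vec d) : EReal :=
  ⨅ u : {u : ℕ → Vec d → S.Γ // ∀ j, Measurable (u j)}, S.costFunctional j₀ x₀ u

/-! ### Bellman operator and subsolutions -/

/-- `f(j, x, γ) + ∫ g(Ψ(j, x, γ, z)) μ(dz)`. -/
def bellmanCost (j : ℕ) (g : Vec d → EReal) (x : Vec d) (γ : S.Γ) : EReal :=
  (S.f j x γ : EReal) + extIntegral S.μ (fun z => g (S.Ψ j x γ z))

/-- The one-step Bellman operator `𝓛_j`. -/
def bellman (j : ℕ) (g : Vec d → EReal) (x : Vec d) : EReal :=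
  ⨅ γ : S.Γ, S.bellmanCost j g x γ

/-- Subsolutions of the control problem (functions on `{0, …, N} × ℝ^d`; values at times after `N`
are irrelevant). -/
structure IsSubsolution (w : ℕ → Vec d → EReal) : Prop where
  lsc : ∀ j ≤ S.N, LowerSemicontinuous (w j)
  bddBelow : ∃ c : ℝ, ∀ j ≤ S.N, ∀ x, (c : EReal) ≤ w j x
  terminal : ∀ x, w S.N x ≤ (S.F x : EReal)
  step : ∀ j < S.N, ∀ x, w j x ≤ S.bellman j (w (j + 1)) x

/-! ### The assumptions -/

/-- The system function is continuous. -/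
def SystemContinuous : Prop :=
  ∀ j, Continuous (fun z : Vec d × S.Γ × Vec d₁ => S.Ψ j z.1 z.2.1 z.2.2)

/-- The cost coefficients are non-negative (hence bounded from below) and lower semicontinuous. -/
structure CostsNonnegLsc : Prop where
  f_nonneg : ∀ j x γ, 0 ≤ S.f j x γ
  F_nonneg : ∀ x, 0 ≤ S.F x
  f_lsc : ∀ j, LowerSemicontinuous (fun z : Vec d × S.Γ => S.f j z.1 z.2)
  F_lsc : LowerSemicontinuous S.F

/-- The terminal costs are convex and of at most linear growth. -/
structure TerminalConvex : Prop where
  convex : ConvexOn ℝ Set.univ S.F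
  growth : LinearGrowth S.F

/-- The space of control actions is compact. -/
def ActionsCompact : Prop := IsCompact S.Γ

/-- The Bellman operator preserves convexity: it maps convex functions that are bounded from below
and of at most linear growth to real valued convex functions. -/
def PreservesConvexity : Prop :=
  ∀ (j : ℕ) (g : Vec d → ℝ), ConvexOn ℝ Set.univ g → BddBelow (Set.range g) → LinearGrowth g →
    ∃ h : Vec d → ℝ, ConvexOn ℝ Set.univ h ∧
      ∀ x, S.bellman j (fun x => (g x : EReal)) x = (h x : EReal)

/-- The Bellman operator controls subgradients. -/
def ControlsSubgradients : Prop :=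
  ∃ c₀ c₁ : ℝ≥0, ∀ g : Vec d → ℝ, ConvexOn ℝ Set.univ g → BddBelow (Set.range g) →
    subgradientNorm (fun x => (g x : EReal)) < ⊤ →
    ∀ j, 1 ≤ j → j < S.N →
      subgradientNorm (S.bellman j (fun x => (g x : EReal)))
        ≤ c₀ + c₁ * subgradientNorm (fun x => (g x : EReal))

variable {Ω : Type*} {mΩ : MeasurableSpace Ω}

/-- `X` is a controlled state sequence up to time `N` with initial law `ν`, driven by the noise
variables `ξ_1, …, ξ_N` and the stochastic control policy `γ_0, …, γ_{N-1}`, with respect to the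
filtration `𝓕`: every `ξ_{j+1}` has law `μ`, is `𝓕_{j+1}`-measurable and independent of `𝓕_j`; every
`γ_j` is `𝓕_j`-measurable; `X_0` is `𝓕_0`-measurable with law `ν`; and
`X_{j+1} = Ψ(j, X_j, γ_j, ξ_{j+1})`. -/
structure IsControlledSequence (ν : Measure (Vec d)) (P : Measure Ω) (𝓕 : Filtration ℕ mΩ)
    (ξ : ℕ → Ω → Vec d₁) (γ : ℕ → Ω → S.Γ) (X : ℕ → Ω → Vec d) : Prop where
  noise_measurable : ∀ j < S.N, Measurable[𝓕 (j + 1)] (ξ (j + 1))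
  noise_law : ∀ j < S.N, P.map (ξ (j + 1)) = S.μ
  noise_indep : ∀ j < S.N,
    Indep (MeasurableSpace.comap (ξ (j + 1)) inferInstance) (𝓕 j) P
  control_measurable : ∀ j < S.N, Measurable[𝓕 j] (γ j)
  initial_measurable : Measurable[𝓕 0] (X 0)
  initial_law : P.map (X 0) = ν
  dynamics : ∀ j < S.N, ∀ ω, X (j + 1) ω = S.Ψ j (X j ω) (γ j ω) (ξ (j + 1) ω)

/-- The total cost `∑_{j<N} f(j, X_j, γ_j) + F(X_N)` of a control sequence and a state sequence. -/
def totalCost (γ : ℕ → Ω → S.Γ) (X : ℕ → Ω → Vec d) (ω : Ω) : ℝ :=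
  ∑ j ∈ Finset.range S.N, S.f j (X j ω) (γ j ω) + S.F (X S.N ω)

/-- Integrability: for every family, indexed by `n ∈ ℕ`, of controlled state sequences on the given
probability space with common initial law `ν`, there is an exponent `p > 1` for which the `p`-th
moments of the costs and of the states are bounded uniformly over the family. -/
def MomentBounds (ν : Measure (Vec d)) (P : Measure Ω) : Prop :=
  ∀ (𝓕 : ℕ → Filtration ℕ mΩ) (ξ : ℕ → ℕ → Ω → Vec d₁) (γ : ℕ → ℕ → Ω → S.Γ)
    (X : ℕ → ℕ → Ω → Vec d),
    (∀ n, S.IsControlledSequence ν P (𝓕 n) (ξ n) (γ n) (X n)) →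
    ∃ p : ℝ, 1 < p ∧
      (⨆ n, ∫⁻ ω, ENNReal.ofReal (S.totalCost (γ n) (X n) ω) ^ p ∂P) < ⊤ ∧
      (⨆ n, ⨆ j ∈ Finset.Icc 1 S.N, ∫⁻ ω, ‖X n j ω‖ₑ ^ p ∂P) < ⊤

/-! ### The algorithm -/

/-- A run of the algorithm on `(Ω, P)`, started from `w₀`, with random initial states of law `ν`.
Iteration `n = 0, 1, 2, …` produces `w (n+1)` from `w n`; here `w n ω j x` is `w^{(n)}_ω(j, x)`.

* `𝓖 n` is the information available before iteration `n`; `𝓕 n j` is the information at time `j` of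
  the trajectory simulated in iteration `n`.
* `X n`, `γ n`, `ξ n` are the states, controls and noise variables of iteration `n`; the initial
  state `X n 0` is drawn independently of the past `𝓖 n`.
* `p n j` are the slopes selected in the updating step of iteration `n`; the selection may use (and
  only use) what is known at the end of that iteration. -/
structure AlgorithmRun (ν : Measure (Vec d)) (P : Measure Ω) (w₀ : ℕ → Vec d → EReal) where
  𝓖 : ℕ → MeasurableSpace Ω
  𝓕 : ℕ → Filtration ℕ mΩ
  ξ : ℕ → ℕ → Ω → Vec d₁
  γ : ℕ → ℕ → Ω → S.Γ
  X : ℕ → ℕ → Ω → Vec d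
  p : ℕ → ℕ → Ω → Vec d
  w : ℕ → Ω → ℕ → Vec d → EReal
  past_le : ∀ n, 𝓖 n ≤ 𝓕 n 0
  le_past : ∀ n, 𝓕 n S.N ≤ 𝓖 (n + 1)
  /-- Trajectory simulation. -/
  controlled : ∀ n, S.IsControlledSequence ν P (𝓕 n) (ξ n) (γ n) (X n)
  initial_indep : ∀ n, Indep (MeasurableSpace.comap (X n 0) inferInstance) (𝓖 n) P
  control_argmin : ∀ n, ∀ j < S.N, ∀ ω, ∀ γ' : S.Γ,
    S.bellmanCost j (w n ω (j + 1)) (X n j ω) (γ n j ω)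
      ≤ S.bellmanCost j (w n ω (j + 1)) (X n j ω) γ'
  /-- Selection of subgradients. -/
  slope_measurable : ∀ n, ∀ j ≤ S.N, Measurable[𝓖 (n + 1)] (p n j)
  slope_terminal : ∀ n ω,
    p n S.N ω ∈ subgradient (fun x => (S.F x : EReal)) (X n S.N ω)
  slope_step : ∀ n, ∀ j < S.N, ∀ ω,
    p n j ω ∈ subgradient (S.bellman j (w (n + 1) ω (j + 1))) (X n j ω)
  /-- Subsolution updating. -/
  init : ∀ ω, ∀ j ≤ S.N, w 0 ω j = w₀ j
  update_terminal : ∀ n ω x,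
    w (n + 1) ω S.N x
      = max (w n ω S.N x) (hyp (X n S.N ω) (S.F (X n S.N ω) : EReal) (p n S.N ω) x)
  update_step : ∀ n, ∀ j < S.N, ∀ ω x,
    w (n + 1) ω j x
      = max (w n ω j x)
          (hyp (X n j ω) (S.bellman j (w (n + 1) ω (j + 1)) (X n j ω)) (p n j ω) x)

end ControlProblem

end

/-! Backward iteration of the Bellman operator yields real convex functions `V j`, and verification
with Borel selections of minimizers (`exists_measurable_argmin`, `valueFunction_eq`) identifies `V
0` with the value function. The iterates increase in `n`, are convex and stay below `V`, so at each
time they converge locally uniformly on every path. The question is whether the limit at time 0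
reaches `V 0`.

The answer comes from the optimality of the simulated controls. Since `γ n j` minimizes the Bellman
cost of `w n`, the gap between `V` and the updated iterate at `X n j` is at most the conditional
expectation of the gap between `V` and the old iterate at `X n (j+1)` (`lintegral_gap_step`).
Replacing old by new at time `j+1` costs one increment `w (n+1) - w n`. Iterating up to the horizon,
where the updated gap vanishes, bounds the expected initial gap by a sum of expected increments
(`lintegral_gap_le_sum`).

These increments tend to zero: on balls by locally uniform convergence, off balls by linear growth
of `V j` and the moment bounds (`tendsto_lintegral_increment`). No limit of controls or trajectories
is taken.

Finally, `X n 0` has law `ν` and is independent of the past, so the expected gap is an expectation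
of `ν`-integrals of `V 0 - w n 0` (`ae_iInf_gap_eq_zero`). Almost surely the limit agrees with `V 0`
`ν`-almost everywhere and, by continuity, on the support. To apply independence, `LscFamily` records
that the random functions depend on `ω` through a parameter known from the past. -/

noncomputable section

/-! ### Lower semicontinuity, minimization over compact sets, measurable selection -/

/-- The infimum is attained, so its sublevel sets are projections of closed sets along the compact
factor, and such projections are closed. -/
theorem lowerSemicontinuous_iInf_of_compact {A K : Type*} [TopologicalSpace A] [TopologicalSpace K]
    [CompactSpace K] [Nonempty K] {h : A × K → EReal} (hh : LowerSemicontinuous h) :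
    LowerSemicontinuous fun a => ⨅ k, h (a, k) := by
  rw [lowerSemicontinuous_iff_isClosed_preimage]
  intro y
  have : (fun a => ⨅ k, h (a, k)) ⁻¹' Set.Iic y = Prod.fst '' (h ⁻¹' Set.Iic y) := by
    ext a
    constructor
    · intro ha
      obtain ⟨k, -, hk⟩ := ((hh.comp (Continuous.prodMk_right a)).lowerSemicontinuousOn
        Set.univ).exists_isMinOn Set.univ_nonempty isCompact_univ
      refine ⟨(a, k), ?_, rfl⟩
      exact (le_iInf fun k' => hk (Set.mem_univ k') : h (a, k) ≤ ⨅ k, h (a, k)).trans ha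
    · rintro ⟨⟨a', k⟩, hk, rfl⟩
      exact (iInf_le (fun k => h (a', k)) k).trans hk
  rw [this]
  exact isClosedMap_fst_of_compactSpace _ (hh.isClosed_preimage y)

theorem exists_eq_iInf_of_compact {K : Type*} [TopologicalSpace K]
    [CompactSpace K] [Nonempty K] {h : K → EReal} (hh : LowerSemicontinuous h) :
    ∃ k, h k = ⨅ k, h k := by
  obtain ⟨k, -, hk⟩ := (hh.lowerSemicontinuousOn Set.univ).exists_isMinOn Set.univ_nonempty
    isCompact_univ
  exact ⟨k, le_antisymm (le_iInf fun k' => hk (Set.mem_univ k')) (iInf_le _ k)⟩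

theorem continuous_cantorFunction {c : ℝ} (h0 : 0 ≤ c) (h1 : c < 1) :
    Continuous (Cardinal.cantorFunction c) := by
  refine continuous_tsum (u := fun n => c ^ n) (fun n => ?_)
    (summable_geometric_of_lt_one h0 h1) (fun n f => ?_)
  · have : Continuous fun b : Bool => (bif b then c ^ n else 0 : ℝ) := continuous_of_discreteTopology
    exact this.comp (continuous_apply n)
  · unfold Cardinal.cantorFunctionAux
    cases f n <;> simp [abs_of_nonneg h0, pow_nonneg h0]

/-- The injection `θ` breaks ties: take the minimizer with the smallest `θ`. Then `θ ∘ u ≤ s` holds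
exactly where the minimum over the compact set `{θ ≤ s}` already equals the full minimum, which
compares two semicontinuous functions. -/
theorem exists_measurable_argmin_of_injective {A K : Type*} [TopologicalSpace A] [MeasurableSpace A]
    [BorelSpace A] [TopologicalSpace K] [CompactSpace K] [Nonempty K] [MeasurableSpace K]
    [BorelSpace K] {θ : K → ℝ} (hθ : Continuous θ) (hinj : Function.Injective θ)
    {h : A × K → EReal} (hh : LowerSemicontinuous h) :
    ∃ u : A → K, Measurable u ∧ ∀ a, h (a, u a) = ⨅ k, h (a, k) := by
  set m : A → EReal := fun a => ⨅ k, h (a, k) with hm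
  have hmm : Measurable m := (lowerSemicontinuous_iInf_of_compact hh).measurable
  have key : ∀ a, ∃ k, h (a, k) = m a ∧ ∀ k', h (a, k') ≤ m a → θ k ≤ θ k' := by
    intro a
    have hlsc : LowerSemicontinuous fun k => h (a, k) := hh.comp (Continuous.prodMk_right a)
    obtain ⟨k₀, hk₀⟩ := exists_eq_iInf_of_compact hlsc
    have hc : IsCompact {k | h (a, k) ≤ m a} := (hlsc.isClosed_preimage (m a)).isCompact
    obtain ⟨k, hk, hmin⟩ := hc.exists_isMinOn ⟨k₀, hk₀.le⟩ hθ.continuousOn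
    exact ⟨k, le_antisymm hk (iInf_le _ k), fun k' hk' => hmin hk'⟩
  choose u hu hmin using key
  refine ⟨u, ?_, hu⟩
  have hemb : MeasurableEmbedding θ := (hθ.isClosedEmbedding hinj).measurableEmbedding
  rw [← hemb.measurable_comp_iff]
  refine measurable_of_Iic fun s => ?_
  have hset : (θ ∘ u) ⁻¹' Set.Iic s = {a | ∃ k : {k // θ k ≤ s}, h (a, k) ≤ m a} := by
    ext a
    constructor
    · intro ha
      exact ⟨⟨u a, ha⟩, (hu a).le⟩
    · rintro ⟨⟨k, hk⟩, hle⟩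
      exact (hmin a k hle).trans hk
  rw [hset]
  have : CompactSpace {k // θ k ≤ s} :=
    isCompact_iff_compactSpace.mp (isClosed_le hθ continuous_const).isCompact
  rcases isEmpty_or_nonempty {k // θ k ≤ s} with hE | hN
  · convert MeasurableSet.empty
    ext a
    simp only [Set.mem_ofPred_eq, Set.mem_empty_iff_false, iff_false]
    rintro ⟨k, -⟩
    exact hE.elim k
  · have hh' : LowerSemicontinuous fun z : A × {k // θ k ≤ s} => h (z.1, z.2) :=
      hh.comp (by fun_prop : Continuous fun z : A × {k // θ k ≤ s} => ((z.1, (z.2 : K)) : A × K))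
    convert measurableSet_le (lowerSemicontinuous_iInf_of_compact hh').measurable hmm using 1
    ext a
    constructor
    · rintro ⟨k, hk⟩
      exact (iInf_le (fun k : {k // θ k ≤ s} => h (a, k)) k).trans hk
    · intro ha
      obtain ⟨k, hk⟩ := exists_eq_iInf_of_compact (hh'.comp (Continuous.prodMk_right a))
      exact ⟨k, hk.le.trans ha⟩

/-- A lower semicontinuous function on `A × K` with `K` a compact metric space admits a Borel
selection of minimizers in the second variable. -/
theorem exists_measurable_argmin {A K : Type*} [TopologicalSpace A] [MeasurableSpace A]
    [BorelSpace A] [MetricSpace K] [CompactSpace K] [Nonempty K] [MeasurableSpace K]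
    [BorelSpace K] {h : A × K → EReal} (hh : LowerSemicontinuous h) :
    ∃ u : A → K, Measurable u ∧ ∀ a, h (a, u a) = ⨅ k, h (a, k) := by
  -- `K` is a continuous image of Cantor space, which the Cantor function with ratio below `1/2`
  -- embeds in `ℝ`; minimizers are selected there and pushed forward.
  obtain ⟨φ, hφ, hsurj⟩ := exists_nat_bool_continuous_surjective_of_compact K
  have hlsc : LowerSemicontinuous fun z : A × (ℕ → Bool) => h (z.1, φ z.2) :=
    hh.comp (by fun_prop : Continuous fun z : A × (ℕ → Bool) => (z.1, φ z.2))
  obtain ⟨u, hu, hmin⟩ := exists_measurable_argmin_of_injective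
    (continuous_cantorFunction (c := 1 / 3) (by norm_num) (by norm_num))
    (Cardinal.cantorFunction_injective (by norm_num) (by norm_num)) hlsc
  refine ⟨φ ∘ u, hφ.measurable.comp hu, fun a => ?_⟩
  exact (hmin a).trans (hsurj.iInf_comp fun k => h (a, k))

/-- Fatou's lemma along `𝓝 a`; first countability makes this filter countably generated. -/
theorem lowerSemicontinuous_lintegral {A Y : Type*} [TopologicalSpace A] [FirstCountableTopology A]
    [MeasurableSpace Y] (μ : Measure Y) {g : A → Y → ℝ≥0∞} (hm : ∀ a, Measurable (g a))
    (hg : ∀ y, LowerSemicontinuous fun a => g a y) :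
    LowerSemicontinuous fun a => ∫⁻ y, g a y ∂μ := by
  rw [lowerSemicontinuous_iff_le_liminf]
  intro a
  exact (lintegral_mono fun y => (lowerSemicontinuous_iff_le_liminf.mp (hg y)) a).trans
    (lintegral_liminf_le hm)

/-! ### The extended integral -/

/-- This is `(g - c)⁺ - g⁺ + g⁻ = c⁻ - c⁺`, rearranged so that only sums occur in `ℝ≥0∞`. -/
theorem toENNReal_add_neg_coe_balance (g : EReal) (c : ℝ) (h : (c : EReal) ≤ g) :
    (g + ((-c : ℝ) : EReal)).toENNReal + (-g).toENNReal + ENNReal.ofReal c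
      = g.toENNReal + ENNReal.ofReal (-c) := by
  induction g with
  | bot => simp at h
  | top => simp
  | coe r =>
    have hr : c ≤ r := by exact_mod_cast h
    rw [← EReal.coe_add, ← EReal.coe_neg]
    simp only [EReal.real_coe_toENNReal]
    rcases le_total 0 r with h1 | h1 <;> rcases le_total 0 c with h2 | h2
    · rw [ENNReal.ofReal_of_nonpos (neg_nonpos.mpr h1), ENNReal.ofReal_of_nonpos (neg_nonpos.mpr h2),
        add_zero, add_zero, ← ENNReal.ofReal_add (by linarith) h2]
      congr 1; ring
    · rw [ENNReal.ofReal_of_nonpos (neg_nonpos.mpr h1), ENNReal.ofReal_of_nonpos h2,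
        add_zero, add_zero, ← ENNReal.ofReal_add h1 (by linarith)]
    · have hr0 : r = 0 := by linarith
      have hc0 : c = 0 := by linarith
      simp [hr0, hc0]
    · rw [ENNReal.ofReal_of_nonpos h1, ENNReal.ofReal_of_nonpos h2,
        add_zero, zero_add, ← ENNReal.ofReal_add (by linarith) (by linarith)]
      congr 1; ring

theorem continuous_ereal_add_coe (c : ℝ) : Continuous fun e : EReal => e + (c : EReal) :=
  continuous_iff_continuousAt.mpr fun e =>
    (EReal.continuousAt_add (p := (e, (c : EReal))) (Or.inr (EReal.coe_ne_bot _))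
      (Or.inr (EReal.coe_ne_top _))).comp (f := fun e => (e, (c : EReal)))
      (Continuous.prodMk_left _).continuousAt

/-- Shifting by the lower bound leaves a single integral of a nonnegative function, to which Fatou's
lemma and monotonicity apply. -/
theorem extIntegral_eq_lintegral_add {α : Type*} [MeasurableSpace α] (μ : Measure α)
    [IsProbabilityMeasure μ] {g : α → EReal} (hg : Measurable g) (c : ℝ)
    (hc : ∀ a, (c : EReal) ≤ g a) :
    extIntegral μ g
      = ((∫⁻ a, (g a + ((-c : ℝ) : EReal)).toENNReal ∂μ : ℝ≥0∞) : EReal) + (c : EReal) := by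
  have hmg : Measurable fun a => (g a).toENNReal := hg.ereal_toENNReal
  have hmn : Measurable fun a => (-g a).toENNReal := hg.neg.ereal_toENNReal
  have hms : Measurable fun a => (g a + ((-c : ℝ) : EReal)).toENNReal :=
    ((continuous_ereal_add_coe (-c)).measurable.comp hg).ereal_toENNReal
  have hfin : ∫⁻ a, (-g a).toENNReal ∂μ ≤ ENNReal.ofReal (-c) := by
    refine (lintegral_mono (g := fun _ => ENNReal.ofReal (-c)) fun a => ?_).trans (by simp)
    have : -g a ≤ ((-c : ℝ) : EReal) := by
      rw [EReal.coe_neg]; exact EReal.neg_le_neg_iff.mpr (hc a)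
    simpa using EReal.toENNReal_le_toENNReal this
  have hsum : ∫⁻ a, (g a + ((-c : ℝ) : EReal)).toENNReal ∂μ + ∫⁻ a, (-g a).toENNReal ∂μ
      + ENNReal.ofReal c = ∫⁻ a, (g a).toENNReal ∂μ + ENNReal.ofReal (-c) := by
    have h1 : ENNReal.ofReal c = ∫⁻ _, ENNReal.ofReal c ∂μ := by simp
    have h2 : ENNReal.ofReal (-c) = ∫⁻ _, ENNReal.ofReal (-c) ∂μ := by simp
    have hmsn : Measurable fun a => (g a + ((-c : ℝ) : EReal)).toENNReal + (-g a).toENNReal :=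
      hms.add hmn
    rw [h1, h2, ← lintegral_add_left hms, ← lintegral_add_left hmsn, ← lintegral_add_left hmg]
    exact lintegral_congr fun a => toENNReal_add_neg_coe_balance (g a) c (hc a)
  unfold extIntegral
  generalize ∫⁻ a, (g a + ((-c : ℝ) : EReal)).toENNReal ∂μ = A at *
  generalize ∫⁻ a, (-g a).toENNReal ∂μ = B at *
  generalize ∫⁻ a, (g a).toENNReal ∂μ = C at *
  have hB : B ≠ ⊤ := (hfin.trans_lt ENNReal.ofReal_lt_top).ne
  by_cases hA : A = ⊤
  · have hC : C = ⊤ := by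
      by_contra hC
      have : C + ENNReal.ofReal (-c) ≠ ⊤ := ENNReal.add_ne_top.mpr ⟨hC, ENNReal.ofReal_ne_top⟩
      rw [← hsum, hA] at this
      simp at this
    lift B to ℝ≥0 using hB
    rw [hA, hC, EReal.coe_ennreal_top, EReal.top_add_coe]
    rfl
  · have hC : C ≠ ⊤ := by
      intro hC
      have : A + B + ENNReal.ofReal c ≠ ⊤ :=
        ENNReal.add_ne_top.mpr ⟨ENNReal.add_ne_top.mpr ⟨hA, hB⟩, ENNReal.ofReal_ne_top⟩
      rw [hsum, hC] at this
      simp at this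
    lift A to ℝ≥0 using hA
    lift B to ℝ≥0 using hB
    lift C to ℝ≥0 using hC
    have hs : (A : ℝ) + B + max c 0 = C + max (-c) 0 := by
      have := congrArg ENNReal.toReal hsum
      rw [ENNReal.toReal_add (by finiteness) (by finiteness),
        ENNReal.toReal_add (by finiteness) (by finiteness),
        ENNReal.toReal_add (by finiteness) (by finiteness)] at this
      simpa [ENNReal.toReal_ofReal'] using this
    have hreal : (C : ℝ) - B = A + c := by
      rcases le_total 0 c with h | h
      · rw [max_eq_left h, max_eq_right (by linarith)] at hs; linarith
      · rw [max_eq_right h, max_eq_left (by linarith)] at hs; linarith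
    have e : ∀ r : ℝ≥0, (((r : ℝ≥0∞)) : EReal) = ((r : ℝ) : EReal) := fun r => rfl
    rw [e, e, e, ← EReal.coe_sub, ← EReal.coe_add, hreal]

theorem extIntegral_mono {α : Type*} [MeasurableSpace α] (μ : Measure α) {g h : α → EReal}
    (hgh : ∀ a, g a ≤ h a) : extIntegral μ g ≤ extIntegral μ h := by
  refine EReal.sub_le_sub ?_ ?_
  · exact EReal.coe_ennreal_le_coe_ennreal_iff.mpr
      (lintegral_mono fun a => EReal.toENNReal_le_toENNReal (hgh a))
  · exact EReal.coe_ennreal_le_coe_ennreal_iff.mpr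
      (lintegral_mono fun a => EReal.toENNReal_le_toENNReal (EReal.neg_le_neg_iff.mpr (hgh a)))

theorem coe_le_extIntegral {α : Type*} [MeasurableSpace α] (μ : Measure α)
    [IsProbabilityMeasure μ] {g : α → EReal} (c : ℝ) (hc : ∀ a, (c : EReal) ≤ g a) :
    (c : EReal) ≤ extIntegral μ g := by
  refine le_trans ?_ (extIntegral_mono μ hc)
  rw [extIntegral_eq_lintegral_add μ measurable_const c fun _ => le_rfl]
  exact le_add_of_nonneg_left (EReal.coe_ennreal_nonneg _)

theorem extIntegral_coe_of_nonneg {α : Type*} [MeasurableSpace α] (μ : Measure α)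
    {g : α → ℝ} (hg : ∀ a, 0 ≤ g a) :
    extIntegral μ (fun a => (g a : EReal)) = ((∫⁻ a, ENNReal.ofReal (g a) ∂μ : ℝ≥0∞) : EReal) := by
  have : ∀ a, ENNReal.ofReal (-g a) = 0 := fun a => ENNReal.ofReal_of_nonpos (by linarith [hg a])
  simp [extIntegral, ← EReal.coe_neg, this]

/-- The additive form avoids subtracting integrals that may be infinite. -/
theorem extIntegral_le_add_lintegral {α : Type*} [MeasurableSpace α] (μ : Measure α)
    [IsProbabilityMeasure μ] {g h : α → ℝ} (hg : Measurable g) (hh : Measurable h) (c : ℝ)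
    (hc : ∀ a, c ≤ g a) (hgh : ∀ a, g a ≤ h a) :
    extIntegral μ (fun a => (h a : EReal))
      ≤ extIntegral μ (fun a => (g a : EReal))
        + ((∫⁻ a, ENNReal.ofReal (h a - g a) ∂μ : ℝ≥0∞) : EReal) := by
  rw [extIntegral_eq_lintegral_add μ hg.coe_real_ereal c fun a => by exact_mod_cast hc a,
    extIntegral_eq_lintegral_add μ hh.coe_real_ereal c
      fun a => by exact_mod_cast (hc a).trans (hgh a), add_right_comm]
  refine add_le_add_left ?_ _
  rw [← EReal.coe_ennreal_add, EReal.coe_ennreal_le_coe_ennreal_iff]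
  simp only [← EReal.coe_add, EReal.real_coe_toENNReal]
  have hm : Measurable fun a => ENNReal.ofReal (h a - g a) :=
    ENNReal.measurable_ofReal.comp (hh.sub hg)
  rw [← lintegral_add_right _ hm]
  refine lintegral_mono fun a => ?_
  rw [← ENNReal.ofReal_add (by linarith [hc a]) (by linarith [hgh a])]
  exact ENNReal.ofReal_le_ofReal (by linarith)

/-! ### Independence and iterated integrals -/

/-- If `ξ` is independent of `m` and `τ` is `m`-measurable, the expectation of `Φ (τ, ξ)` may be
computed by integrating first over the law of `ξ`. -/
theorem lintegral_prodMk_of_indep {Ω A Y : Type*} {m mΩ : MeasurableSpace Ω} [MeasurableSpace A]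
    [mY : MeasurableSpace Y] (P : Measure Ω) [IsProbabilityMeasure P]
    (hm : m ≤ mΩ) {τ : Ω → A} (hτ : Measurable[m] τ) {ξ : Ω → Y} (hξ : Measurable[mΩ] ξ)
    (hind : Indep (MeasurableSpace.comap ξ mY) m P) {Φ : A × Y → ℝ≥0∞} (hΦ : Measurable Φ) :
    ∫⁻ ω, Φ (τ ω, ξ ω) ∂P = ∫⁻ ω, ∫⁻ y, Φ (τ ω, y) ∂(P.map ξ) ∂P := by
  have hτ' : Measurable[mΩ] τ := hτ.mono hm le_rfl
  have hI : IndepFun τ ξ P := by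
    rw [IndepFun_iff_Indep]
    exact (indep_of_indep_of_le_right hind hτ.comap_le).symm
  have hprod := (indepFun_iff_map_prod_eq_prod_map_map hτ'.aemeasurable hξ.aemeasurable).mp hI
  have hpr : IsProbabilityMeasure (P.map ξ) := Measure.isProbabilityMeasure_map hξ.aemeasurable
  rw [← lintegral_map hΦ (hτ'.prodMk hξ), hprod, lintegral_prod _ hΦ.aemeasurable]
  exact lintegral_map hΦ.lintegral_prod_right' hτ'

/-! ### Convex functions and their subgradients -/

theorem mem_subgradient_coe {n : ℕ} {g : Vec n → ℝ} {x p : Vec n} :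
    p ∈ subgradient (fun x => (g x : EReal)) x ↔ ∀ y, g x + inner ℝ p (y - x) ≤ g y := by
  refine forall_congr' fun y => ?_
  unfold hyp
  rw [← EReal.coe_add, EReal.coe_le_coe_iff]

theorem ExtConvex.convexOn {n : ℕ} {g : Vec n → ℝ} (h : ExtConvex fun x => (g x : EReal)) :
    ConvexOn ℝ Set.univ g := by
  refine ⟨convex_univ, fun x _ y _ a b ha hb hab => ?_⟩
  have hx : (x, g x) ∈ {z : Vec n × ℝ | (g z.1 : EReal) ≤ (z.2 : EReal)} :=
    le_refl ((g x : ℝ) : EReal)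
  have hy : (y, g y) ∈ {z : Vec n × ℝ | (g z.1 : EReal) ≤ (z.2 : EReal)} :=
    le_refl ((g y : ℝ) : EReal)
  have : (g (a • x + b • y) : EReal) ≤ ((a • g x + b • g y : ℝ) : EReal) := h hx hy ha hb hab
  exact_mod_cast this

theorem convexOn_affine {n : ℕ} (v : ℝ) (p xbar : Vec n) :
    ConvexOn ℝ Set.univ fun x : Vec n => v + inner ℝ p (x - xbar) := by
  refine ⟨convex_univ, fun x _ y _ a b ha hb hab => le_of_eq ?_⟩
  have : a • x + b • y - xbar = a • (x - xbar) + b • (y - xbar) := by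
    rw [smul_sub, smul_sub, sub_add_sub_comm, ← add_smul, hab, one_smul]
  simp only [this, inner_add_right, inner_smul_right, smul_eq_mul]
  linear_combination (-v) * hab

/-- Hahn–Banach separates `(x, g x)` from the strict epigraph, which is open because a finite convex
function on `ℝⁿ` is continuous. The separating functional has a positive vertical component;
dividing by it gives the slope. -/
theorem ConvexOn.exists_subgradient {n : ℕ} {g : Vec n → ℝ} (hg : ConvexOn ℝ Set.univ g)
    (x : Vec n) : ∃ p : Vec n, ∀ y, g x + inner ℝ p (y - x) ≤ g y := by
  have hcont : Continuous g := hg.locallyLipschitz.continuous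
  obtain ⟨L, hL⟩ := geometric_hahn_banach_point_open (E := Vec n × ℝ)
    (t := {z | z.1 ∈ Set.univ ∧ g z.1 < z.2}) (x := (x, g x)) hg.convex_strict_epigraph
    (by simpa using isOpen_lt (hcont.comp continuous_fst) continuous_snd) (by simp)
  have hlin : ∀ (y : Vec n) (s : ℝ), L (y, s) = L (y, 0) + s * L (0, 1) := fun y s => by
    have : ((y, s) : Vec n × ℝ) = (y, 0) + s • ((0 : Vec n), (1 : ℝ)) := by ext <;> simp
    rw [this, map_add, map_smul, smul_eq_mul]
  have ha : 0 < L (0, 1) := by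
    have := hL (x, g x + 1) ⟨trivial, by simp⟩
    rw [hlin x (g x), hlin x (g x + 1)] at this
    linarith
  set a := L (0, 1)
  have hle : ∀ y, L (x, 0) + g x * a ≤ L (y, 0) + g y * a := fun y => by
    refine le_of_forall_pos_le_add fun ε hε => ?_
    have := hL (y, g y + ε / a) ⟨trivial, by simp; positivity⟩
    rw [hlin x, hlin y] at this
    have e : (g y + ε / a) * a = g y * a + ε := by field_simp
    linarith
  let ℓ : Vec n →L[ℝ] ℝ := -a⁻¹ • L.comp (ContinuousLinearMap.inl ℝ (Vec n) ℝ)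
  refine ⟨(InnerProductSpace.toDual ℝ (Vec n)).symm ℓ, fun y => ?_⟩
  rw [InnerProductSpace.toDual_symm_apply]
  have hℓ : ∀ y, ℓ y = -a⁻¹ * L (y, 0) := fun y => by simp [ℓ]
  rw [map_sub, hℓ, hℓ]
  have h1 := hle y
  have : a⁻¹ * (L (x, 0) + g x * a) ≤ a⁻¹ * (L (y, 0) + g y * a) :=
    mul_le_mul_of_nonneg_left h1 (inv_nonneg.mpr ha.le)
  have e : ∀ r : ℝ, a⁻¹ * (r * a) = r := fun r => by field_simp
  rw [mul_add, mul_add, e, e] at this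
  linarith

/-- Along the ray `x + t • p` the supporting hyperplane rises at rate `‖p‖ ^ 2`, while the growth
bound allows only `C * ‖p‖`; hence `‖p‖ ≤ C`. -/
theorem LinearGrowth.subgradientNorm_lt_top {n : ℕ} {g : Vec n → ℝ} (hg : LinearGrowth g) :
    subgradientNorm (fun x => (g x : EReal)) < ⊤ := by
  obtain ⟨C, hC⟩ := hg
  have hC0 : 0 ≤ C := by
    have := (abs_nonneg _).trans (hC 0)
    simpa using this
  refine (iSup_le fun x => iSup₂_le fun p hp => ?_).trans_lt (ENNReal.ofReal_lt_top (r := C))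
  rw [mem_subgradient_coe] at hp
  rw [← ofReal_norm]
  refine ENNReal.ofReal_le_ofReal ?_
  by_contra! hlt
  have hpos : 0 < ‖p‖ := hC0.trans_lt hlt
  set M := C * (1 + ‖x‖) - g x with hM
  set δ := ‖p‖ * (‖p‖ - C) with hδ
  have hδ0 : 0 < δ := mul_pos hpos (by linarith)
  have key : ∀ t : ℝ, 0 ≤ t → t * δ ≤ M := fun t ht => by
    have h1 := hp (x + t • p)
    have h2 := (le_abs_self _).trans (hC (x + t • p))
    have h3 : ‖x + t • p‖ ≤ ‖x‖ + t * ‖p‖ := (norm_add_le _ _).trans (by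
      rw [norm_smul, Real.norm_of_nonneg ht])
    rw [add_sub_cancel_left, inner_smul_right, real_inner_self_eq_norm_sq] at h1
    have h4 := mul_le_mul_of_nonneg_left h3 hC0
    rw [hδ, hM]
    nlinarith
  have := key ((|M| + 1) / δ) (by positivity)
  rw [div_mul_cancel₀ _ hδ0.ne'] at this
  linarith [le_abs_self M]

/-- A subgradient exists at every point, so a bound on their norms is a Lipschitz constant. -/
theorem ConvexOn.linearGrowth_of_subgradientNorm {n : ℕ} {g : Vec n → ℝ}
    (hg : ConvexOn ℝ Set.univ g) (h : subgradientNorm (fun x => (g x : EReal)) < ⊤) :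
    LinearGrowth g := by
  set K := (subgradientNorm fun x => (g x : EReal)).toReal with hK
  have hK0 : 0 ≤ K := ENNReal.toReal_nonneg
  have hlip : ∀ x y, g x - g y ≤ K * ‖y - x‖ := fun x y => by
    obtain ⟨p, hp⟩ := hg.exists_subgradient x
    have hpK : ‖p‖ ≤ K := by
      rw [← toReal_enorm]
      refine ENNReal.toReal_mono h.ne ?_
      exact le_iSup_of_le x (le_iSup₂_of_le p (mem_subgradient_coe.mpr hp) le_rfl)
    have h1 := (abs_le.mp (abs_real_inner_le_norm p (y - x))).1
    have h2 := mul_le_mul_of_nonneg_right hpK (norm_nonneg (y - x))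
    linarith [hp y]
  refine ⟨|g 0| + K, fun x => ?_⟩
  have h1 := hlip x 0
  have h2 := hlip 0 x
  rw [zero_sub, norm_neg] at h1
  rw [sub_zero] at h2
  have := neg_abs_le (g 0)
  have := le_abs_self (g 0)
  have := mul_nonneg (abs_nonneg (g 0)) (norm_nonneg x)
  rw [abs_le]
  constructor <;> nlinarith

/-- A bounded increasing sequence of convex functions converges, locally uniformly, to a continuous
function. -/
theorem exists_limit_of_monotone_convexOn {n : ℕ} {w : ℕ → Vec n → ℝ} {V : Vec n → ℝ}
    (hconv : ∀ k, ConvexOn ℝ Set.univ (w k)) (hmono : Monotone w) (hV : ∀ k x, w k x ≤ V x) :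
    ∃ u : Vec n → ℝ, Continuous u ∧ (∀ k x, w k x ≤ u x) ∧ (∀ x, u x ≤ V x) ∧
      TendstoLocallyUniformly w u atTop := by
  have hbdd : ∀ x, BddAbove (Set.range fun k => w k x) := fun x =>
    ⟨V x, by rintro _ ⟨k, rfl⟩; exact hV k x⟩
  have hlim : ∀ x, Tendsto (fun k => w k x) atTop (𝓝 (⨆ k, w k x)) := fun x =>
    tendsto_atTop_ciSup (fun _ _ h => hmono h x) (hbdd x)
  have hc : ConvexOn ℝ Set.univ fun x => ⨆ k, w k x := by
    refine ⟨convex_univ, fun x _ y _ a b ha hb hab => ?_⟩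
    exact le_of_tendsto_of_tendsto' (hlim _)
      (((hlim x).const_smul a).add ((hlim y).const_smul b))
      fun k => (hconv k).2 trivial trivial ha hb hab
  -- A finite convex limit is continuous, which is what Dini's theorem requires below.
  have hcont := hc.locallyLipschitz.continuous
  exact ⟨_, hcont, fun k x => le_ciSup (hbdd x) k, fun x => ciSup_le fun k => hV k x,
    hmono.tendstoLocallyUniformly_of_forall_tendsto
      (fun k => (hconv k).locallyLipschitz.continuous) hcont hlim⟩

/-- The increments of a bounded increasing sequence of convex functions tend to zero along any
bounded sequence of points. -/
theorem tendsto_increment_of_monotone_convexOn {n : ℕ} {w : ℕ → Vec n → ℝ} {V : Vec n → ℝ}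
    (hconv : ∀ k, ConvexOn ℝ Set.univ (w k)) (hmono : Monotone w) (hV : ∀ k x, w k x ≤ V x)
    (R : ℝ) (x : ℕ → Vec n) :
    Tendsto (fun k => if ‖x k‖ ≤ R then w (k + 1) (x k) - w k (x k) else 0) atTop (𝓝 0) := by
  obtain ⟨u, -, hle, -, hu⟩ := exists_limit_of_monotone_convexOn hconv hmono hV
  -- The points move with `k`, so uniformity on the ball is needed; the increment is at most `u - w
  -- k`, as `w (k + 1) ≤ u`.
  have hunif : TendstoUniformlyOn w u atTop (Metric.closedBall 0 R) :=
    (tendstoLocallyUniformlyOn_iff_tendstoUniformlyOn_of_compact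
      (isCompact_closedBall _ _)).mp hu.tendstoLocallyUniformlyOn
  rw [Metric.tendsto_atTop]
  intro ε hε
  obtain ⟨K, hK⟩ := eventually_atTop.mp (Metric.tendstoUniformlyOn_iff.mp hunif ε hε)
  refine ⟨K, fun k hk => ?_⟩
  split_ifs with h
  · have h1 := hK k hk (x k) (by simpa using h)
    rw [Real.dist_eq] at h1 ⊢
    have h2 : w k (x k) ≤ w (k + 1) (x k) := hmono k.le_succ (x k)
    have h3 := hle (k + 1) (x k)
    rw [sub_zero, abs_of_nonneg (by linarith)]
    linarith [le_abs_self (u (x k) - w k (x k))]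
  · simpa using hε

namespace ControlProblem

variable {d d₁ d₂ : ℕ} (S : ControlProblem d d₁ d₂)

/-! ### Semicontinuity and monotonicity of the Bellman operator -/

theorem SystemContinuous.continuous_fst {S : ControlProblem d d₁ d₂} (hA1 : S.SystemContinuous)
    (j : ℕ) (y : Vec d₁) : Continuous fun z : Vec d × S.Γ => S.Ψ j z.1 z.2 y :=
  (hA1 j).comp (by fun_prop : Continuous fun z : Vec d × S.Γ => (z.1, z.2, y))

theorem SystemContinuous.continuous_snd {S : ControlProblem d d₁ d₂} (hA1 : S.SystemContinuous)
    (j : ℕ) (x : Vec d) (γ : S.Γ) : Continuous fun y => S.Ψ j x γ y :=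
  (hA1 j).comp (by fun_prop : Continuous fun y : Vec d₁ => (x, γ, y))

/-- The parameter in `T` will carry the randomness of the iterates. Joint semicontinuity in
parameter, state and action serves both the selection of minimizers and measurability in `ω`. -/
theorem lowerSemicontinuous_bellmanCost {S : ControlProblem d d₁ d₂} (hA1 : S.SystemContinuous)
    (hA2 : S.CostsNonnegLsc)
    {T : Type*} [TopologicalSpace T] [FirstCountableTopology T] {G : T × Vec d → EReal}
    (hG : LowerSemicontinuous G) (c : ℝ) (hc : ∀ z, (c : EReal) ≤ G z) (j : ℕ) :
    LowerSemicontinuous fun z : (T × Vec d) × S.Γ =>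
      S.bellmanCost j (fun x => G (z.1.1, x)) z.1.2 z.2 := by
  have := S.μ_prob
  have hmeas : ∀ z : (T × Vec d) × S.Γ, Measurable fun y => G (z.1.1, S.Ψ j z.1.2 z.2 y) := fun z =>
    (hG.comp (Continuous.prodMk_right z.1.1 |>.comp (hA1.continuous_snd j z.1.2 z.2))).measurable
  have heq : (fun z : (T × Vec d) × S.Γ => S.bellmanCost j (fun x => G (z.1.1, x)) z.1.2 z.2)
      = fun z => (S.f j z.1.2 z.2 : EReal)
        + (((∫⁻ y, (G (z.1.1, S.Ψ j z.1.2 z.2 y) + ((-c : ℝ) : EReal)).toENNReal ∂S.μ : ℝ≥0∞) :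
          EReal) + (c : EReal)) := by
    funext z
    unfold bellmanCost
    rw [extIntegral_eq_lintegral_add S.μ (hmeas z) c fun _ => hc _]
  rw [heq]
  have hf : LowerSemicontinuous fun z : (T × Vec d) × S.Γ => (S.f j z.1.2 z.2 : EReal) :=
    continuous_coe_real_ereal.comp_lowerSemicontinuous
      ((hA2.f_lsc j).comp
        (by fun_prop : Continuous fun z : (T × Vec d) × S.Γ => (z.1.2, z.2)))
      EReal.coe_strictMono.monotone
  have hshift : Monotone fun e : EReal => e + ((-c : ℝ) : EReal) := fun _ _ h => add_le_add_left h _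
  have hint : LowerSemicontinuous fun z : (T × Vec d) × S.Γ =>
      ∫⁻ y, (G (z.1.1, S.Ψ j z.1.2 z.2 y) + ((-c : ℝ) : EReal)).toENNReal ∂S.μ := by
    refine lowerSemicontinuous_lintegral S.μ
      (fun z => ((continuous_ereal_add_coe (-c)).measurable.comp (hmeas z)).ereal_toENNReal)
      fun y => ?_
    have h1 : LowerSemicontinuous fun z : (T × Vec d) × S.Γ => G (z.1.1, S.Ψ j z.1.2 z.2 y) :=
      hG.comp (Continuous.prodMk (by fun_prop)
        ((hA1.continuous_fst j y).comp
          (by fun_prop : Continuous fun z : (T × Vec d) × S.Γ => (z.1.2, z.2))))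
    exact EReal.continuous_toENNReal.comp_lowerSemicontinuous
      ((continuous_ereal_add_coe (-c)).comp_lowerSemicontinuous h1 hshift)
      fun _ _ h => EReal.toENNReal_le_toENNReal h
  have hint' := continuous_coe_ennreal_ereal.comp_lowerSemicontinuous hint
    EReal.coe_ennreal_strictMono.monotone
  have hint'' := (continuous_ereal_add_coe c).comp_lowerSemicontinuous hint'
    (fun _ _ h => add_le_add_left h _)
  exact hf.add' hint'' fun z => EReal.continuousAt_add (Or.inl (EReal.coe_ne_top _))
    (Or.inl (EReal.coe_ne_bot _))

theorem lowerSemicontinuous_bellman {S : ControlProblem d d₁ d₂} (hA1 : S.SystemContinuous)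
    (hA2 : S.CostsNonnegLsc) [CompactSpace S.Γ] [Nonempty S.Γ]
    {T : Type*} [TopologicalSpace T] [FirstCountableTopology T] {G : T × Vec d → EReal}
    (hG : LowerSemicontinuous G) (c : ℝ) (hc : ∀ z, (c : EReal) ≤ G z) (j : ℕ) :
    LowerSemicontinuous fun z : T × Vec d => S.bellman j (fun x => G (z.1, x)) z.2 :=
  lowerSemicontinuous_iInf_of_compact (lowerSemicontinuous_bellmanCost hA1 hA2 hG c hc j)

theorem bellmanCost_mono {g h : Vec d → EReal} (hgh : ∀ x, g x ≤ h x) (j : ℕ) (x : Vec d)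
    (γ : S.Γ) : S.bellmanCost j g x γ ≤ S.bellmanCost j h x γ :=
  add_le_add_right (extIntegral_mono S.μ fun _ => hgh _) _

theorem bellman_mono {g h : Vec d → EReal} (hgh : ∀ x, g x ≤ h x) (j : ℕ) (x : Vec d) :
    S.bellman j g x ≤ S.bellman j h x :=
  iInf_mono fun γ => S.bellmanCost_mono hgh j x γ

theorem coe_le_bellman {S : ControlProblem d d₁ d₂} (hA2 : S.CostsNonnegLsc)
    {g : Vec d → EReal} (c : ℝ) (hc : ∀ x, (c : EReal) ≤ g x)
    (j : ℕ) (x : Vec d) : (c : EReal) ≤ S.bellman j g x := by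
  have := S.μ_prob
  refine le_iInf fun γ => ?_
  have h1 : (0 : EReal) ≤ (S.f j x γ : EReal) := by exact_mod_cast hA2.f_nonneg j x γ
  calc (c : EReal) = 0 + (c : EReal) := (zero_add _).symm
    _ ≤ _ := add_le_add h1 (coe_le_extIntegral S.μ c fun _ => hc _)

theorem bellmanCost_coe_of_nonneg {S : ControlProblem d d₁ d₂} (hA2 : S.CostsNonnegLsc)
    {g : Vec d → ℝ} (hg : ∀ x, 0 ≤ g x) (j : ℕ) (x : Vec d) (γ : S.Γ) :
    S.bellmanCost j (fun x => (g x : EReal)) x γ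
      = ((ENNReal.ofReal (S.f j x γ) + ∫⁻ z, ENNReal.ofReal (g (S.Ψ j x γ z)) ∂S.μ : ℝ≥0∞) :
        EReal) := by
  unfold bellmanCost
  rw [extIntegral_coe_of_nonneg S.μ fun _ => hg _, EReal.coe_ennreal_add,
    EReal.coe_ennreal_ofReal, max_eq_left (hA2.f_nonneg j x γ)]

/-! ### Dynamic programming -/

/-- `V` solves the dynamic programming equation with terminal value `F`, and has the regularity
that the assumptions provide. -/
structure IsDynamicProgram (V : ℕ → Vec d → ℝ) : Prop where
  terminal : V S.N = S.F
  step : ∀ j < S.N, ∀ x, S.bellman j (fun x => (V (j + 1) x : EReal)) x = (V j x : EReal)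
  convex : ∀ j ≤ S.N, ConvexOn ℝ Set.univ (V j)
  nonneg : ∀ j ≤ S.N, ∀ x, 0 ≤ V j x
  growth : ∀ j ≤ S.N, 1 ≤ j → LinearGrowth (V j)

/-- Backward iteration of the Bellman operator: `k` steps before the time horizon. -/
def costToGo : ℕ → Vec d → ℝ
  | 0 => S.F
  | k + 1 => fun x => (S.bellman (S.N - (k + 1)) (fun x => (costToGo k x : EReal)) x).toReal

/-- Convexity is preserved only for functions of linear growth, so growth has to be carried
backwards: it bounds the subgradients, (A6) transfers the bound to the next function, and bounded
subgradients give growth again. -/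
theorem exists_isDynamicProgram {S : ControlProblem d d₁ d₂} (hA2 : S.CostsNonnegLsc)
    (hA3 : S.TerminalConvex) (hA5 : S.PreservesConvexity) (hA6 : S.ControlsSubgradients) :
    ∃ V : ℕ → Vec d → ℝ, S.IsDynamicProgram V := by
  obtain ⟨W, hW0, hWs⟩ : ∃ W : ℕ → Vec d → ℝ, W 0 = S.F ∧ ∀ k, W (k + 1) = fun x =>
      (S.bellman (S.N - (k + 1)) (fun x => (W k x : EReal)) x).toReal :=
    ⟨S.costToGo, rfl, fun _ => rfl⟩
  obtain ⟨c₀, c₁, hsub⟩ := hA6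
  -- Here `k` counts steps back from the horizon. For positive `N` the value `k = N` is time 0,
  -- where (A6) gives no bound, so growth is not claimed there.
  have key : ∀ k ≤ S.N, (ConvexOn ℝ Set.univ (W k) ∧ (∀ x, 0 ≤ W k x) ∧
      (k < S.N ∨ k = 0 → LinearGrowth (W k))) ∧
      (∀ i < k, ∀ x, S.bellman (S.N - (i + 1)) (fun x => (W i x : EReal)) x
        = (W (i + 1) x : EReal)) := by
    intro k
    induction k with
    | zero =>
      rw [hW0]
      exact fun _ => ⟨⟨hA3.convex, hA2.F_nonneg, fun _ => hA3.growth⟩, fun i hi => by omega⟩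
    | succ k ih =>
      intro hk
      obtain ⟨⟨hconv, hnn, hgr⟩, hst⟩ := ih (by omega)
      have hgr := hgr (Or.inl (by omega))
      have hbdd : BddBelow (Set.range (W k)) := ⟨0, by rintro _ ⟨x, rfl⟩; exact hnn x⟩
      obtain ⟨h, hh, hbh⟩ := hA5 (S.N - (k + 1)) (W k) hconv hbdd hgr
      have heq : W (k + 1) = h := by
        rw [hWs]; funext x; rw [hbh x]; rfl
      have hb : ∀ x, S.bellman (S.N - (k + 1)) (fun x => (W k x : EReal)) x
          = (W (k + 1) x : EReal) := fun x => by rw [heq, hbh]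
      have hcW : ConvexOn ℝ Set.univ (W (k + 1)) := heq ▸ hh
      refine ⟨⟨hcW, fun x => ?_, fun hlt => ?_⟩, fun i hi => ?_⟩
      · have h0 := coe_le_bellman hA2 (g := fun x => (W k x : EReal)) 0
          (fun x => by exact_mod_cast hnn x) (S.N - (k + 1)) x
        rw [hb] at h0
        exact_mod_cast h0
      · have hn := hsub (W k) hconv hbdd hgr.subgradientNorm_lt_top (S.N - (k + 1)) (by omega)
          (by omega)
        rw [show S.bellman (S.N - (k + 1)) (fun x => (W k x : EReal))
          = fun x => (W (k + 1) x : EReal) from funext hb] at hn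
        refine hcW.linearGrowth_of_subgradientNorm
          (hn.trans_lt ?_)
        exact ENNReal.add_lt_top.mpr ⟨ENNReal.coe_lt_top,
          ENNReal.mul_lt_top ENNReal.coe_lt_top hgr.subgradientNorm_lt_top⟩
      · rcases Nat.lt_succ_iff_lt_or_eq.mp hi with h1 | rfl
        · exact hst i h1
        · exact hb
  refine ⟨fun j => W (S.N - j), ⟨by simp [hW0], fun j hj x => ?_, fun j hj => ?_, fun j hj => ?_,
    fun j hj h1 => ?_⟩⟩
  · have h := (key S.N le_rfl).2 (S.N - (j + 1)) (by omega) x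
    have e1 : S.N - (j + 1) + 1 = S.N - j := by omega
    have e2 : S.N - (S.N - j) = j := by omega
    rw [e1, e2] at h
    exact h
  · exact (key (S.N - j) (by omega)).1.1
  · exact (key (S.N - j) (by omega)).1.2.1
  · exact (key (S.N - j) (by omega)).1.2.2 (by omega)

variable {S} in
theorem IsDynamicProgram.continuous {V : ℕ → Vec d → ℝ} (hV : S.IsDynamicProgram V) {j : ℕ}
    (hj : j ≤ S.N) : Continuous (V j) := (hV.convex j hj).locallyLipschitz.continuous

/-! ### Controlled state sequences -/

section Controlled

variable {S} {Ω : Type*} {mΩ : MeasurableSpace Ω} {P : Measure Ω}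
  {ν : Measure (Vec d)} {𝓕 : Filtration ℕ mΩ} {ξ : ℕ → Ω → Vec d₁} {γ : ℕ → Ω → S.Γ}
  {X : ℕ → Ω → Vec d}

theorem IsControlledSequence.measurable_state (h : S.IsControlledSequence ν P 𝓕 ξ γ X)
    (hA1 : S.SystemContinuous) : ∀ j ≤ S.N, Measurable[𝓕 j] (X j) := by
  intro j
  induction j with
  | zero => exact fun _ => h.initial_measurable
  | succ j ih =>
    intro hj
    have h1 : Measurable[𝓕 (j + 1)] (X j) := (ih (by omega)).mono (𝓕.mono j.le_succ) le_rfl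
    have h2 : Measurable[𝓕 (j + 1)] (γ j) :=
      (h.control_measurable j hj).mono (𝓕.mono j.le_succ) le_rfl
    have h3 := h.noise_measurable j hj
    rw [show X (j + 1) = fun ω => S.Ψ j (X j ω) (γ j ω) (ξ (j + 1) ω) from
      funext (h.dynamics j hj)]
    exact (hA1 j).measurable.comp (h1.prodMk (h2.prodMk h3))

/-- Conditioning on the past: the expectation of a function of the past and of the next state. -/
theorem IsControlledSequence.lintegral_next [IsProbabilityMeasure P]
    (h : S.IsControlledSequence ν P 𝓕 ξ γ X)
    (hA1 : S.SystemContinuous) {j : ℕ} (hj : j < S.N) {T : Type*} [MeasurableSpace T] {τ : Ω → T}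
    (hτ : Measurable[𝓕 j] τ) {Φ : T × Vec d → ℝ≥0∞} (hΦ : Measurable Φ) :
    ∫⁻ ω, Φ (τ ω, X (j + 1) ω) ∂P
      = ∫⁻ ω, ∫⁻ z, Φ (τ ω, S.Ψ j (X j ω) (γ j ω) z) ∂S.μ ∂P := by
  have hΨ : Measurable fun a : (T × Vec d × S.Γ) × Vec d₁ =>
      (a.1.1, S.Ψ j a.1.2.1 a.1.2.2 a.2) := by
    refine Measurable.prodMk (by fun_prop) ?_
    exact (hA1 j).measurable.comp
      (by fun_prop : Measurable fun a : (T × Vec d × S.Γ) × Vec d₁ => (a.1.2.1, a.1.2.2, a.2))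
  have := lintegral_prodMk_of_indep P (𝓕.le j)
    (hτ.prodMk ((h.measurable_state hA1 j hj.le).prodMk (h.control_measurable j hj)))
    ((h.noise_measurable j hj).mono (𝓕.le _) le_rfl) (h.noise_indep j hj)
    (Φ := fun a : (T × Vec d × S.Γ) × Vec d₁ => Φ (a.1.1, S.Ψ j a.1.2.1 a.1.2.2 a.2))
    (hΦ.comp hΨ)
  rw [h.noise_law j hj] at this
  rw [← this]
  exact lintegral_congr fun ω => by rw [h.dynamics j hj ω]

/-- The one-step tower property on which both verification results rest; nonnegativity makes
integrability irrelevant. -/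
theorem IsControlledSequence.lintegral_add_lintegral_next [IsProbabilityMeasure P]
    (h : S.IsControlledSequence ν P 𝓕 ξ γ X)
    (hA1 : S.SystemContinuous) (hA2 : S.CostsNonnegLsc) {V : ℕ → Vec d → ℝ}
    (hV : S.IsDynamicProgram V) {j : ℕ} (hj : j < S.N) :
    ∫⁻ ω, ENNReal.ofReal (S.f j (X j ω) (γ j ω)) ∂P + ∫⁻ ω, ENNReal.ofReal (V (j + 1) (X (j + 1) ω)) ∂P
      = ∫⁻ ω, (S.bellmanCost j (fun x => (V (j + 1) x : EReal)) (X j ω) (γ j ω)).toENNReal ∂P := by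
  have hm1 : Measurable[mΩ] fun ω => (X j ω, γ j ω) :=
    ((h.measurable_state hA1 j hj.le).prodMk (h.control_measurable j hj)).mono (𝓕.le j) le_rfl
  have hf : Measurable[mΩ] fun ω => ENNReal.ofReal (S.f j (X j ω) (γ j ω)) :=
    ENNReal.measurable_ofReal.comp ((hA2.f_lsc j).measurable.comp hm1)
  have hnext := h.lintegral_next hA1 hj (T := Unit) (τ := fun _ => ()) measurable_const
    (Φ := fun a => ENNReal.ofReal (V (j + 1) a.2))
    (ENNReal.measurable_ofReal.comp ((hV.continuous hj).measurable.comp measurable_snd))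
  rw [hnext, ← lintegral_add_left hf]
  refine lintegral_congr fun ω => ?_
  rw [bellmanCost_coe_of_nonneg hA2 (hV.nonneg (j + 1) hj), EReal.toENNReal_coe]

theorem lintegral_totalCost (h : S.IsControlledSequence ν P 𝓕 ξ γ X)
    (hA1 : S.SystemContinuous) (hA2 : S.CostsNonnegLsc) :
    ∫⁻ ω, ENNReal.ofReal (S.totalCost γ X ω) ∂P
      = ∑ j ∈ Finset.range S.N, ∫⁻ ω, ENNReal.ofReal (S.f j (X j ω) (γ j ω)) ∂P
        + ∫⁻ ω, ENNReal.ofReal (S.F (X S.N ω)) ∂P := by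
  have hf : ∀ j ∈ Finset.range S.N, Measurable[mΩ] fun ω =>
      ENNReal.ofReal (S.f j (X j ω) (γ j ω)) := fun j hj => by
    have hj := Finset.mem_range.mp hj
    exact ENNReal.measurable_ofReal.comp ((hA2.f_lsc j).measurable.comp
      (((h.measurable_state hA1 j hj.le).prodMk
        (h.control_measurable j hj)).mono (𝓕.le j) le_rfl))
  rw [← lintegral_finsetSum _ hf, ← lintegral_add_left (Finset.measurable_sum _ hf)]
  refine lintegral_congr fun ω => ?_
  unfold totalCost
  rw [ENNReal.ofReal_add (Finset.sum_nonneg fun _ _ => hA2.f_nonneg _ _ _) (hA2.F_nonneg _),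
    ENNReal.ofReal_sum_of_nonneg fun _ _ => hA2.f_nonneg _ _ _]

/-- At each step `V` is an infimum over actions, so the chosen action can only cost more; the steps
telescope. -/
theorem IsControlledSequence.lintegral_initial_le [IsProbabilityMeasure P]
    (h : S.IsControlledSequence ν P 𝓕 ξ γ X)
    (hA1 : S.SystemContinuous) (hA2 : S.CostsNonnegLsc) {V : ℕ → Vec d → ℝ}
    (hV : S.IsDynamicProgram V) :
    ∫⁻ ω, ENNReal.ofReal (V 0 (X 0 ω)) ∂P ≤ ∫⁻ ω, ENNReal.ofReal (S.totalCost γ X ω) ∂P := by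
  have key : ∀ k ≤ S.N, ∫⁻ ω, ENNReal.ofReal (V 0 (X 0 ω)) ∂P
      ≤ ∑ j ∈ Finset.range k, ∫⁻ ω, ENNReal.ofReal (S.f j (X j ω) (γ j ω)) ∂P
        + ∫⁻ ω, ENNReal.ofReal (V k (X k ω)) ∂P := by
    intro k
    induction k with
    | zero => intro _; simp
    | succ k ih =>
      intro hk
      refine (ih (by omega)).trans ?_
      rw [Finset.sum_range_succ, add_assoc, h.lintegral_add_lintegral_next hA1 hA2 hV hk]
      gcongr with ω
      rw [← EReal.real_coe_toENNReal, ← hV.step k hk]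
      exact EReal.toENNReal_le_toENNReal (iInf_le _ _)
  rw [lintegral_totalCost h hA1 hA2, ← hV.terminal]
  exact key S.N le_rfl

theorem IsControlledSequence.lintegral_initial_eq [IsProbabilityMeasure P]
    (h : S.IsControlledSequence ν P 𝓕 ξ γ X)
    (hA1 : S.SystemContinuous) (hA2 : S.CostsNonnegLsc) {V : ℕ → Vec d → ℝ}
    (hV : S.IsDynamicProgram V)
    (hopt : ∀ j < S.N, ∀ ω, S.bellmanCost j (fun x => (V (j + 1) x : EReal)) (X j ω) (γ j ω)
      = S.bellman j (fun x => (V (j + 1) x : EReal)) (X j ω)) :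
    ∫⁻ ω, ENNReal.ofReal (V 0 (X 0 ω)) ∂P = ∫⁻ ω, ENNReal.ofReal (S.totalCost γ X ω) ∂P := by
  have key : ∀ k ≤ S.N, ∫⁻ ω, ENNReal.ofReal (V 0 (X 0 ω)) ∂P
      = ∑ j ∈ Finset.range k, ∫⁻ ω, ENNReal.ofReal (S.f j (X j ω) (γ j ω)) ∂P
        + ∫⁻ ω, ENNReal.ofReal (V k (X k ω)) ∂P := by
    intro k
    induction k with
    | zero => intro _; simp
    | succ k ih =>
      intro hk
      rw [ih (by omega), Finset.sum_range_succ, add_assoc,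
        h.lintegral_add_lintegral_next hA1 hA2 hV hk]
      congr 1
      refine lintegral_congr fun ω => ?_
      rw [hopt k hk, hV.step k hk, EReal.real_coe_toENNReal]
  rw [lintegral_totalCost h hA1 hA2, ← hV.terminal]
  exact key S.N le_rfl

end Controlled

/-! ### The value function -/

/-- This makes the verification results applicable to feedback policies, with a Dirac initial law.
-/
theorem isControlledSequence_feedbackState {S : ControlProblem d d₁ d₂} (hA1 : S.SystemContinuous)
    {u : ℕ → Vec d → S.Γ} (hu : ∀ j, Measurable (u j)) (x : Vec d) :
    S.IsControlledSequence (Measure.dirac x)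
      (Measure.infinitePi fun _ : ℕ => S.μ)
      (Filtration.natural (fun i (y : ℕ → Vec d₁) => y i)
        fun i => (measurable_pi_apply i).stronglyMeasurable)
      (fun i y => y i) (fun j y => u j (S.feedbackState u 0 x y j))
      (fun j y => S.feedbackState u 0 x y j) := by
  have := S.μ_prob
  set 𝓕 := Filtration.natural (fun i (y : ℕ → Vec d₁) => y i)
    fun i => (measurable_pi_apply i).stronglyMeasurable
  have hnoise : ∀ i, Measurable[𝓕 i] fun y : ℕ → Vec d₁ => y i := fun i =>
    (Filtration.stronglyAdapted_natural (u := fun i (y : ℕ → Vec d₁) => y i)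
      (fun i => (measurable_pi_apply i).stronglyMeasurable) i).measurable
  have hdyn : ∀ j (y : ℕ → Vec d₁), S.feedbackState u 0 x y (j + 1)
      = S.Ψ j (S.feedbackState u 0 x y j) (u j (S.feedbackState u 0 x y j)) (y (j + 1)) :=
    fun j y => by simp [feedbackState]
  have hX : ∀ j, Measurable[𝓕 j] fun y => S.feedbackState u 0 x y j := by
    intro j
    induction j with
    | zero => exact measurable_const
    | succ j ih =>
      have h1 : Measurable[𝓕 (j + 1)] fun y => S.feedbackState u 0 x y j :=
        ih.mono (𝓕.mono j.le_succ) le_rfl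
      simp only [hdyn]
      exact (hA1 j).measurable.comp (h1.prodMk (((hu j).comp h1).prodMk (hnoise (j + 1))))
  refine ⟨fun j _ => hnoise (j + 1), fun j _ => ?_, fun j _ => ?_, fun j _ => (hu j).comp (hX j),
    hX 0, ?_, fun j _ y => hdyn j y⟩
  · exact (measurePreserving_eval_infinitePi (fun _ : ℕ => S.μ) (j + 1)).map_eq
  · exact iIndepFun.indep_comap_natural_of_lt _
      (iIndepFun_infinitePi (P := fun _ : ℕ => S.μ) (X := fun _ y => y) fun _ => measurable_id)
      j.lt_succ_self
  · change Measure.map (fun _ => x) _ = _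
    rw [Measure.map_const]
    simp

theorem costFunctional_eq {S : ControlProblem d d₁ d₂} (hA2 : S.CostsNonnegLsc)
    (u : ℕ → Vec d → S.Γ) (x : Vec d) :
    S.costFunctional 0 x u = ((∫⁻ y, ENNReal.ofReal (S.totalCost
      (fun j (y : ℕ → Vec d₁) => u j (S.feedbackState u 0 x y j))
      (fun j y => S.feedbackState u 0 x y j) y)
      ∂(Measure.infinitePi fun _ : ℕ => S.μ) : ℝ≥0∞) : EReal) := by
  unfold costFunctional
  rw [extIntegral_coe_of_nonneg]
  · simp only [totalCost, Finset.range_eq_Ico]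
  · exact fun y => add_nonneg (Finset.sum_nonneg fun _ _ => hA2.f_nonneg _ _ _) (hA2.F_nonneg _)

/-- The solution of the dynamic programming equation is the value function. -/
theorem IsDynamicProgram.valueFunction_eq {S : ControlProblem d d₁ d₂} (hA1 : S.SystemContinuous)
    (hA2 : S.CostsNonnegLsc) [CompactSpace S.Γ] [Nonempty S.Γ] {V : ℕ → Vec d → ℝ}
    (hV : S.IsDynamicProgram V) (x : Vec d) : S.valueFunction 0 x = (V 0 x : EReal) := by
  have := S.μ_prob
  have hinit : ∀ u : ℕ → Vec d → S.Γ, ((∫⁻ y, ENNReal.ofReal (V 0 (S.feedbackState u 0 x y 0))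
      ∂(Measure.infinitePi fun _ : ℕ => S.μ) : ℝ≥0∞) : EReal) = (V 0 x : EReal) := fun u => by
    simp [feedbackState, EReal.coe_ennreal_ofReal, hV.nonneg 0 (Nat.zero_le _) x]
  refine le_antisymm ?_ (le_iInf fun ⟨u, hu⟩ => ?_)
  -- Borel selections of Bellman minimizers form an optimal policy; from the horizon on any constant
  -- action will do.
  · have hsel : ∀ j, ∃ u : Vec d → S.Γ, Measurable u ∧ (j < S.N → ∀ x,
        S.bellmanCost j (fun x => (V (j + 1) x : EReal)) x (u x)
          = S.bellman j (fun x => (V (j + 1) x : EReal)) x) := fun j => by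
      by_cases hj : j < S.N
      · have hlsc := lowerSemicontinuous_bellmanCost hA1 hA2 (T := Unit)
          (G := fun z => (V (j + 1) z.2 : EReal))
          (continuous_coe_real_ereal.comp
            ((hV.continuous hj).comp continuous_snd)).lowerSemicontinuous 0
          (fun z => by exact_mod_cast hV.nonneg (j + 1) hj z.2) j
        obtain ⟨u, hu, hopt⟩ := exists_measurable_argmin (hlsc.comp
          (by fun_prop : Continuous fun z : Vec d × S.Γ => (((), z.1), z.2)))
        exact ⟨u, hu, fun _ => hopt⟩
      · exact ⟨fun _ => Classical.arbitrary _, measurable_const, fun h => absurd h hj⟩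
    choose u hu hopt using hsel
    refine (iInf_le _ ⟨u, hu⟩).trans ?_
    rw [costFunctional_eq hA2, ← hinit u,
      (isControlledSequence_feedbackState hA1 hu x).lintegral_initial_eq hA1 hA2 hV
        fun j hj y => hopt j hj _]
  · rw [costFunctional_eq hA2, ← hinit u, EReal.coe_ennreal_le_coe_ennreal_iff]
    exact (isControlledSequence_feedbackState hA1 hu x).lintegral_initial_le hA1 hA2 hV

end ControlProblem

/-! ### Vanishing expectations -/

/-- Uniform integrability by hand: for `r ≥ 1`, on `{Y > r}` one has `e ≤ 2 * D * Y ≤ 2 * D * r ^ (1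
- p) * Y ^ p`, so the tail is small uniformly in `n`. -/
theorem tendsto_lintegral_of_truncation {Ω : Type*} {mΩ : MeasurableSpace Ω} (P : Measure Ω)
    {e Y : ℕ → Ω → ℝ} (hY : ∀ n, Measurable (Y n)) {D : ℝ}
    (hD : 0 ≤ D) (hbound : ∀ n ω, e n ω ≤ D * (1 + Y n ω)) {p : ℝ} (hp : 1 < p)
    (hmom : (⨆ n, ∫⁻ ω, ENNReal.ofReal (Y n ω) ^ p ∂P) < ⊤)
    (htrunc : ∀ r : ℝ,
      Tendsto (fun n => ∫⁻ ω, ENNReal.ofReal (if Y n ω ≤ r then e n ω else 0) ∂P) atTop (𝓝 0)) :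
    Tendsto (fun n => ∫⁻ ω, ENNReal.ofReal (e n ω) ∂P) atTop (𝓝 0) := by
  set M := ⨆ n, ∫⁻ ω, ENNReal.ofReal (Y n ω) ^ p ∂P with hM
  have hsplit : ∀ r : ℝ, 1 ≤ r → ∀ n, ∫⁻ ω, ENNReal.ofReal (e n ω) ∂P
      ≤ ∫⁻ ω, ENNReal.ofReal (if Y n ω ≤ r then e n ω else 0) ∂P
        + ENNReal.ofReal (2 * D * r ^ (1 - p)) * M := fun r hr n => by
    have hpt : ∀ ω, ENNReal.ofReal (e n ω) ≤ ENNReal.ofReal (if Y n ω ≤ r then e n ω else 0)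
        + ENNReal.ofReal (2 * D * r ^ (1 - p)) * ENNReal.ofReal (Y n ω) ^ p := fun ω => by
      split_ifs with h
      · exact le_self_add
      · have h1 : r < Y n ω := not_le.mp h
        have hY1 : 0 < Y n ω := by linarith
        rw [ENNReal.ofReal_zero, zero_add, ENNReal.ofReal_rpow_of_pos hY1,
          ← ENNReal.ofReal_mul (by positivity)]
        refine ENNReal.ofReal_le_ofReal ((hbound n ω).trans ?_)
        have h2 : Y n ω ^ (1 - p) ≤ r ^ (1 - p) :=
          Real.rpow_le_rpow_of_nonpos (by linarith) h1.le (by linarith)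
        have h3 : Y n ω = Y n ω ^ (1 - p) * Y n ω ^ p := by
          rw [← Real.rpow_add hY1, sub_add_cancel, Real.rpow_one]
        have h4 : 0 ≤ Y n ω ^ p := by positivity
        calc D * (1 + Y n ω) ≤ 2 * D * Y n ω := by nlinarith
          _ = 2 * D * (Y n ω ^ (1 - p) * Y n ω ^ p) := by rw [← h3]
          _ ≤ 2 * D * (r ^ (1 - p) * Y n ω ^ p) := by gcongr
          _ = _ := by ring
    refine (lintegral_mono hpt).trans ?_
    have hm : Measurable fun ω => ENNReal.ofReal (Y n ω) ^ p :=
      (ENNReal.measurable_ofReal.comp (hY n)).pow_const p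
    rw [lintegral_add_right _ (hm.const_mul _), lintegral_const_mul _ hm]
    gcongr
    exact le_iSup (fun n => ∫⁻ ω, ENNReal.ofReal (Y n ω) ^ p ∂P) n
  have htail : Tendsto (fun r : ℝ => ENNReal.ofReal (2 * D * r ^ (1 - p)) * M) atTop (𝓝 0) := by
    have h1 : Tendsto (fun r : ℝ => 2 * D * r ^ (1 - p)) atTop (𝓝 0) := by
      have := (tendsto_rpow_neg_atTop (y := p - 1) (by linarith)).const_mul (2 * D)
      simpa using this
    have h2 := ENNReal.Tendsto.mul_const (b := M) (ENNReal.tendsto_ofReal h1) (Or.inr hmom.ne)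
    simpa using h2
  rw [ENNReal.tendsto_nhds_zero] at htail ⊢
  intro ε hε
  have hε2 : 0 < ε / 2 := ENNReal.half_pos hε.ne'
  obtain ⟨r, hr, hr1⟩ := ((htail _ hε2).and (eventually_ge_atTop 1)).exists
  filter_upwards [(ENNReal.tendsto_nhds_zero.mp (htrunc r)) _ hε2] with n hn
  exact (hsplit r hr1 n).trans ((add_le_add hn hr).trans_eq (ENNReal.add_halves ε))

/-! ### Measurable families of lower semicontinuous functions -/

/-- A family of functions that depends on `ω` through an `m`-measurable parameter, in a jointly
lower semicontinuous way, and that is bounded from below by `c`. -/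
def LscFamily {Ω : Type*} {n : ℕ} (m : MeasurableSpace Ω) (c : ℝ) (g : Ω → Vec n → EReal) : Prop :=
  ∃ (T : Type) (_ : TopologicalSpace T) (_ : SecondCountableTopology T) (_ : MeasurableSpace T)
    (_ : BorelSpace T) (τ : Ω → T) (G : T × Vec n → EReal),
    Measurable[m] τ ∧ LowerSemicontinuous G ∧ (∀ z, (c : EReal) ≤ G z) ∧
      ∀ ω x, g ω x = G (τ ω, x)

theorem LscFamily.mono {Ω : Type*} {n : ℕ} {m m' : MeasurableSpace Ω} {c : ℝ}
    {g : Ω → Vec n → EReal} (h : LscFamily m c g) (hm : m ≤ m') : LscFamily m' c g := by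
  obtain ⟨T, i1, i2, i3, i4, τ, G, hτ, hG⟩ := h
  exact ⟨T, i1, i2, i3, i4, τ, G, hτ.mono hm le_rfl, hG⟩

theorem LscFamily.const {Ω : Type*} {n : ℕ} {m : MeasurableSpace Ω} {c : ℝ}
    {g : Vec n → EReal} (hg : LowerSemicontinuous g) (hc : ∀ x, (c : EReal) ≤ g x) :
    LscFamily m c fun _ : Ω => g :=
  ⟨Unit, inferInstance, inferInstance, inferInstance, inferInstance, fun _ => (), fun z => g z.2,
    measurable_const, hg.comp continuous_snd, fun z => hc z.2, fun _ _ => rfl⟩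

/-- Closure under the update of the algorithm: the parameter is enlarged by the state, the slope and
the parameter of the level `v`. The lower bound survives because the maximum includes `g`. -/
theorem LscFamily.max_hyp {Ω : Type*} {n : ℕ} {m : MeasurableSpace Ω} {c : ℝ}
    {g : Ω → Vec n → EReal} (hg : LscFamily m c g) {T : Type} [TopologicalSpace T]
    [SecondCountableTopology T] [MeasurableSpace T] [BorelSpace T] {τ : Ω → T}
    (hτ : Measurable[m] τ) {v : T × Vec n → EReal} (hv : LowerSemicontinuous v) {X p : Ω → Vec n}
    (hX : Measurable[m] X) (hp : Measurable[m] p) :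
    LscFamily m c fun ω x => max (g ω x) (hyp (X ω) (v (τ ω, X ω)) (p ω) x) := by
  obtain ⟨T', i1, i2, i3, i4, τ', G, hτ', hG, hc, hgG⟩ := hg
  refine ⟨(T' × T) × (Vec n × Vec n), inferInstance, inferInstance, inferInstance, inferInstance,
    fun ω => ((τ' ω, τ ω), (X ω, p ω)),
    fun z => max (G (z.1.1.1, z.2)) (hyp z.1.2.1 (v (z.1.1.2, z.1.2.1)) z.1.2.2 z.2),
    (hτ'.prodMk hτ).prodMk (hX.prodMk hp), ?_, fun z => (hc _).trans (le_max_left _ _),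
    fun ω x => by simp only [hgG]⟩
  have h1 : LowerSemicontinuous fun z : ((T' × T) × (Vec n × Vec n)) × Vec n =>
      G (z.1.1.1, z.2) := hG.comp (by fun_prop)
  have h2 : LowerSemicontinuous fun z : ((T' × T) × (Vec n × Vec n)) × Vec n =>
      v (z.1.1.2, z.1.2.1) := hv.comp (by fun_prop)
  have h3 : LowerSemicontinuous fun z : ((T' × T) × (Vec n × Vec n)) × Vec n =>
      ((inner ℝ z.1.2.2 (z.2 - z.1.2.1) : ℝ) : EReal) :=
    (continuous_coe_real_ereal.comp (by fun_prop)).lowerSemicontinuous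
  exact h1.sup (h2.add' h3 fun z => EReal.continuousAt_add (Or.inr (EReal.coe_ne_bot _))
    (Or.inr (EReal.coe_ne_top _)))

theorem LscFamily.measurable_toReal {Ω : Type*} {n : ℕ} {m : MeasurableSpace Ω} {c : ℝ}
    {g : Ω → Vec n → EReal} (hg : LscFamily m c g) {X : Ω → Vec n} (hX : Measurable[m] X) :
    Measurable[m] fun ω => (g ω (X ω)).toReal := by
  obtain ⟨T, i1, i2, i3, i4, τ, G, hτ, hG, hc, hgG⟩ := hg
  simp only [hgG]
  exact measurable_ereal_toReal.comp (hG.measurable.comp (hτ.prodMk hX))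

namespace ControlProblem

variable {d d₁ d₂ : ℕ} {S : ControlProblem d d₁ d₂}

theorem IsSubsolution.le_of_isDynamicProgram {w : ℕ → Vec d → EReal} (hw : S.IsSubsolution w)
    {V : ℕ → Vec d → ℝ} (hV : S.IsDynamicProgram V) {j : ℕ} (hj : j ≤ S.N) :
    ∀ x, w j x ≤ (V j x : EReal) := by
  refine Nat.decreasingInduction (motive := fun j _ => ∀ x, w j x ≤ (V j x : EReal))
    (fun k hk ih x => ?_) (fun x => ?_) hj
  · rw [← hV.step k hk]
    exact (hw.step k hk x).trans (S.bellman_mono ih k x)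
  · rw [hV.terminal]
    exact hw.terminal x

/-- `w₀` is a convex subsolution bounded from below by `c`, and `V` solves the dynamic programming
equation. -/
structure InitialBounds (S : ControlProblem d d₁ d₂) (w₀ : ℕ → Vec d → EReal) (V : ℕ → Vec d → ℝ)
    (c : ℝ) : Prop where
  sub : S.IsSubsolution w₀
  dp : S.IsDynamicProgram V
  lower : ∀ j ≤ S.N, ∀ x, (c : EReal) ≤ w₀ j x
  convex : ∀ j ≤ S.N, ExtConvex (w₀ j)

/-! ### Runs of the algorithm -/

namespace AlgorithmRun

variable {Ω : Type*} {mΩ : MeasurableSpace Ω} {P : Measure Ω} {ν : Measure (Vec d)}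
  {w₀ : ℕ → Vec d → EReal} (R : S.AlgorithmRun ν P w₀)

theorem past_le_ambient (n : ℕ) : R.𝓖 n ≤ mΩ := (R.past_le n).trans ((R.𝓕 n).le 0)

theorem trajectory_le_past (n : ℕ) {j : ℕ} (hj : j ≤ S.N) : R.𝓕 n j ≤ R.𝓖 (n + 1) :=
  ((R.𝓕 n).mono hj).trans (R.le_past n)

theorem past_le_next (n : ℕ) : R.𝓖 n ≤ R.𝓖 (n + 1) :=
  (R.past_le n).trans (R.trajectory_le_past n (Nat.zero_le _))

theorem past_le_trajectory (n j : ℕ) : R.𝓖 n ≤ R.𝓕 n j :=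
  (R.past_le n).trans ((R.𝓕 n).mono (Nat.zero_le j))

theorem measurable_state (hA1 : S.SystemContinuous) (n : ℕ) {j : ℕ} (hj : j ≤ S.N) :
    Measurable[R.𝓖 (n + 1)] (R.X n j) :=
  ((R.controlled n).measurable_state hA1 j hj).mono (R.trajectory_le_past n hj) le_rfl

theorem le_succ (n : ℕ) (ω : Ω) {j : ℕ} (hj : j ≤ S.N) (x : Vec d) :
    R.w n ω j x ≤ R.w (n + 1) ω j x := by
  rcases hj.lt_or_eq with h | rfl
  · rw [R.update_step n j h]; exact le_max_left _ _
  · rw [R.update_terminal n]; exact le_max_left _ _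

theorem bellman_le_update (n : ℕ) (ω : Ω) {j : ℕ} (hj : j < S.N) :
    S.bellman j (R.w (n + 1) ω (j + 1)) (R.X n j ω) ≤ R.w (n + 1) ω j (R.X n j ω) := by
  rw [R.update_step n j hj]
  refine le_trans ?_ (le_max_right _ _)
  simp [hyp]

theorem terminal_le_update (n : ℕ) (ω : Ω) :
    (S.F (R.X n S.N ω) : EReal) ≤ R.w (n + 1) ω S.N (R.X n S.N ω) := by
  rw [R.update_terminal n]
  refine le_trans ?_ (le_max_right _ _)
  simp [hyp]

/-- A supporting hyperplane of the Bellman image of `w (n+1)` lies below that image, hence below the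
Bellman image of `V`, which is `V`. The induction follows the order of the updates: forward in `n`,
backward in `j`. -/
theorem le_value (hw₀ : S.IsSubsolution w₀) {V : ℕ → Vec d → ℝ} (hV : S.IsDynamicProgram V)
    (n : ℕ) (ω : Ω) : ∀ {j : ℕ}, j ≤ S.N → ∀ x, R.w n ω j x ≤ (V j x : EReal) := by
  induction n with
  | zero =>
    intro j hj
    rw [R.init ω j hj]
    exact hw₀.le_of_isDynamicProgram hV hj
  | succ n ih =>
    intro j hj
    refine Nat.decreasingInduction
      (motive := fun j _ => ∀ x, R.w (n + 1) ω j x ≤ (V j x : EReal))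
      (fun k hk ihk x => ?_) (fun x => ?_) hj
    · rw [R.update_step n k hk]
      refine max_le (ih hk.le x) ((R.slope_step n k hk ω x).trans ?_)
      rw [← hV.step k hk]
      exact S.bellman_mono ihk k x
    · rw [R.update_terminal n]
      refine max_le (ih le_rfl x) ((R.slope_terminal n ω x).trans ?_)
      rw [hV.terminal]

theorem lower_bound_le {c : ℝ} (hc : ∀ j ≤ S.N, ∀ x, (c : EReal) ≤ w₀ j x) (n : ℕ) (ω : Ω)
    {j : ℕ} (hj : j ≤ S.N) (x : Vec d) : (c : EReal) ≤ R.w n ω j x := by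
  induction n with
  | zero => rw [R.init ω j hj]; exact hc j hj x
  | succ n ih => exact ih.trans (R.le_succ n ω hj x)

/-- The approximations of the value function as real valued functions. -/
def value (n : ℕ) (ω : Ω) (j : ℕ) (x : Vec d) : ℝ := (R.w n ω j x).toReal

variable {V : ℕ → Vec d → ℝ} {c : ℝ}

theorem coe_value (hb : S.InitialBounds w₀ V c) (n : ℕ) (ω : Ω) {j : ℕ} (hj : j ≤ S.N)
    (x : Vec d) : (R.value n ω j x : EReal) = R.w n ω j x :=
  EReal.coe_toReal
    (ne_top_of_le_ne_top (EReal.coe_ne_top _) (R.le_value hb.sub hb.dp n ω hj x))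
    (ne_bot_of_le_ne_bot (EReal.coe_ne_bot _) (R.lower_bound_le hb.lower n ω hj x))

theorem value_le (hb : S.InitialBounds w₀ V c) (n : ℕ) (ω : Ω) {j : ℕ} (hj : j ≤ S.N)
    (x : Vec d) : R.value n ω j x ≤ V j x := by
  have := R.le_value hb.sub hb.dp n ω hj x
  rw [← R.coe_value hb n ω hj] at this
  exact_mod_cast this

theorem le_value_real (hb : S.InitialBounds w₀ V c) (n : ℕ) (ω : Ω) {j : ℕ} (hj : j ≤ S.N)
    (x : Vec d) : c ≤ R.value n ω j x := by
  have := R.lower_bound_le hb.lower n ω hj x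
  rw [← R.coe_value hb n ω hj] at this
  exact_mod_cast this

theorem monotone_value (hb : S.InitialBounds w₀ V c) (ω : Ω) {j : ℕ} (hj : j ≤ S.N) :
    Monotone fun n => R.value n ω j := by
  refine monotone_nat_of_le_succ fun n x => ?_
  have := R.le_succ n ω hj x
  rw [← R.coe_value hb n ω hj, ← R.coe_value hb (n + 1) ω hj] at this
  exact_mod_cast this

theorem convexOn_value (hA2 : S.CostsNonnegLsc) (hb : S.InitialBounds w₀ V c) (n : ℕ)
    (ω : Ω) {j : ℕ} (hj : j ≤ S.N) : ConvexOn ℝ Set.univ (R.value n ω j) := by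
  induction n with
  | zero =>
    refine ExtConvex.convexOn ?_
    rw [show (fun x => (R.value 0 ω j x : EReal)) = w₀ j from
      funext fun x => by rw [R.coe_value hb 0 ω hj, R.init ω j hj]]
    exact hb.convex j hj
  | succ n ih =>
    -- The level of the new hyperplane is finite, since the Bellman image lies between `c` and `V
    -- j`.
    obtain ⟨v, hv⟩ : ∃ v : ℝ, ∀ x, R.value (n + 1) ω j x
        = max (R.value n ω j x) (v + inner ℝ (R.p n j ω) (x - R.X n j ω)) := by
      suffices ∃ v : ℝ, ∀ x, R.w (n + 1) ω j x
          = max (R.w n ω j x) (hyp (R.X n j ω) (v : EReal) (R.p n j ω) x) by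
        obtain ⟨v, hv⟩ := this
        refine ⟨v, fun x => ?_⟩
        have h := hv x
        unfold hyp at h
        rw [← R.coe_value hb (n + 1) ω hj, ← R.coe_value hb n ω hj, ← EReal.coe_add,
          ← EReal.coe_strictMono.monotone.map_max] at h
        exact_mod_cast h
      rcases hj.lt_or_eq with h | rfl
      · refine ⟨(S.bellman j (R.w (n + 1) ω (j + 1)) (R.X n j ω)).toReal, fun x => ?_⟩
        rw [R.update_step n j h, EReal.coe_toReal]
        · refine ne_top_of_le_ne_top (EReal.coe_ne_top (V j (R.X n j ω))) ?_
          rw [← hb.dp.step j h]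
          exact S.bellman_mono (R.le_value hb.sub hb.dp (n + 1) ω h) j _
        · exact ne_bot_of_le_ne_bot (EReal.coe_ne_bot c)
            (coe_le_bellman hA2 c (R.lower_bound_le hb.lower (n + 1) ω h) j _)
      · exact ⟨S.F (R.X n S.N ω), fun x => R.update_terminal n ω x⟩
    rw [show R.value (n + 1) ω j = R.value n ω j ⊔
      fun x => v + inner ℝ (R.p n j ω) (x - R.X n j ω) from funext hv]
    exact ih.sup (convexOn_affine _ _ _)

theorem measurable_value (hA2 : S.CostsNonnegLsc) (hb : S.InitialBounds w₀ V c) (n : ℕ)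
    (ω : Ω) {j : ℕ} (hj : j ≤ S.N) : Measurable (R.value n ω j) :=
  (R.convexOn_value hA2 hb n ω hj).locallyLipschitz.continuous.measurable

/-- The iterate is known before iteration `n` starts, so it can be frozen when integrating over the
new initial state or the new noise. -/
theorem lscFamily (hA1 : S.SystemContinuous) (hA2 : S.CostsNonnegLsc) [CompactSpace S.Γ]
    [Nonempty S.Γ] (hb : S.InitialBounds w₀ V c) (n : ℕ) :
    ∀ {j : ℕ}, j ≤ S.N → LscFamily (R.𝓖 n) c fun ω => R.w n ω j := by
  induction n with
  | zero =>
    intro j hj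
    simp only [R.init _ j hj]
    exact LscFamily.const (hb.sub.lsc j hj) (hb.lower j hj)
  | succ n ih =>
    intro j hj
    refine Nat.decreasingInduction
      (motive := fun j _ => LscFamily (R.𝓖 (n + 1)) c fun ω => R.w (n + 1) ω j)
      (fun k hk ihk => ?_) ?_ hj
    · obtain ⟨T, i1, i2, i3, i4, τ, G, hτ, hG, hc, hgG⟩ := ihk
      have hup : (fun ω => R.w (n + 1) ω k) = fun ω x => max (R.w n ω k x)
          (hyp (R.X n k ω) (S.bellman k (fun x => G (τ ω, x)) (R.X n k ω)) (R.p n k ω) x) := by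
        funext ω x
        rw [R.update_step n k hk, show R.w (n + 1) ω (k + 1) = fun x => G (τ ω, x) from
          funext (hgG ω)]
      rw [hup]
      exact ((ih hk.le).mono (R.past_le_next n)).max_hyp hτ
        (lowerSemicontinuous_bellman hA1 hA2 hG c hc k) (R.measurable_state hA1 n hk.le)
        (R.slope_measurable n k hk.le)
    · have hup : (fun ω => R.w (n + 1) ω S.N) = fun ω x => max (R.w n ω S.N x)
          (hyp (R.X n S.N ω) (S.F (R.X n S.N ω) : EReal) (R.p n S.N ω) x) := by
        funext ω x
        rw [R.update_terminal n]
      rw [hup]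
      have hF : LowerSemicontinuous fun z : Unit × Vec d => (S.F z.2 : EReal) :=
        (continuous_coe_real_ereal.comp_lowerSemicontinuous hA2.F_lsc
          EReal.coe_strictMono.monotone).comp continuous_snd
      exact ((ih le_rfl).mono (R.past_le_next n)).max_hyp (τ := fun _ => ()) measurable_const
        hF (R.measurable_state hA1 n le_rfl) (R.slope_measurable n S.N le_rfl)

/-! ### Expected gaps and increments along the simulated trajectories. -/

section Expectation

variable (hA1 : S.SystemContinuous) (hA2 : S.CostsNonnegLsc) [CompactSpace S.Γ] [Nonempty S.Γ]
  (hb : S.InitialBounds w₀ V c)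

include hA1 hA2 hb

theorem measurable_value_state (n m : ℕ) {j : ℕ} (hj : j ≤ S.N) :
    Measurable[mΩ] fun ω => R.value n ω j (R.X m j ω) :=
  ((R.lscFamily hA1 hA2 hb n hj).mono (R.past_le_ambient n)).measurable_toReal
    ((R.measurable_state hA1 m hj).mono (R.past_le_ambient _) le_rfl)

theorem measurable_gap (n m : ℕ) {j : ℕ} (hj : j ≤ S.N) :
    Measurable[mΩ] fun ω => V j (R.X m j ω) - R.value n ω j (R.X m j ω) :=
  ((hb.dp.continuous hj).measurable.comp
    ((R.measurable_state hA1 m hj).mono (R.past_le_ambient _) le_rfl)).sub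
    (R.measurable_value_state hA1 hA2 hb n m hj)

/-- The control is optimal for `w n` and merely admissible for `V`, so the two Bellman costs are
compared at the same action. The updated iterate enters on the left because its hyperplane at `X n
j` dominates the Bellman image of `w n` there. -/
theorem lintegral_gap_step [IsProbabilityMeasure P] (n : ℕ) {j : ℕ} (hj : j < S.N) :
    ∫⁻ ω, ENNReal.ofReal (V j (R.X n j ω) - R.value (n + 1) ω j (R.X n j ω)) ∂P
      ≤ ∫⁻ ω, ENNReal.ofReal
          (V (j + 1) (R.X n (j + 1) ω) - R.value n ω (j + 1) (R.X n (j + 1) ω)) ∂P := by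
  have hμ := S.μ_prob
  have hpt : ∀ ω, ENNReal.ofReal (V j (R.X n j ω) - R.value (n + 1) ω j (R.X n j ω))
      ≤ ∫⁻ z, ENNReal.ofReal (V (j + 1) (S.Ψ j (R.X n j ω) (R.γ n j ω) z)
          - R.value n ω (j + 1) (S.Ψ j (R.X n j ω) (R.γ n j ω) z)) ∂S.μ := fun ω => by
    set x := R.X n j ω with hx
    set g := R.γ n j ω with hg
    set I := ∫⁻ z, ENNReal.ofReal (V (j + 1) (S.Ψ j x g z)
          - R.value n ω (j + 1) (S.Ψ j x g z)) ∂S.μ with hI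
    have hΨ : Measurable fun z => S.Ψ j x g z := (hA1.continuous_snd j x g).measurable
    have hwcoe : (fun x => (R.value n ω (j + 1) x : EReal)) = R.w n ω (j + 1) :=
      funext fun x => R.coe_value hb n ω hj x
    have h1 : (V j x : EReal) ≤ R.value (n + 1) ω j x + (I : EReal) := calc
      (V j x : EReal) = S.bellman j (fun x => (V (j + 1) x : EReal)) x := (hb.dp.step j hj x).symm
      _ ≤ S.bellmanCost j (fun x => (V (j + 1) x : EReal)) x g := iInf_le _ g
      _ ≤ S.bellmanCost j (fun x => (R.value n ω (j + 1) x : EReal)) x g + (I : EReal) := by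
        unfold bellmanCost
        rw [add_assoc]
        refine add_le_add_right ?_ _
        exact extIntegral_le_add_lintegral S.μ ((R.measurable_value hA2 hb n ω hj).comp hΨ)
          ((hb.dp.continuous hj).measurable.comp hΨ) c
          (fun z => R.le_value_real hb n ω hj _) (fun z => R.value_le hb n ω hj _)
      _ = S.bellmanCost j (R.w n ω (j + 1)) x g + (I : EReal) := by rw [hwcoe]
      _ ≤ S.bellman j (R.w n ω (j + 1)) x + (I : EReal) :=
        add_le_add_left (le_iInf fun γ' => R.control_argmin n j hj ω γ') _
      _ ≤ S.bellman j (R.w (n + 1) ω (j + 1)) x + (I : EReal) :=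
        add_le_add_left (S.bellman_mono (R.le_succ n ω hj) j x) _
      _ ≤ R.w (n + 1) ω j x + (I : EReal) :=
        add_le_add_left (R.bellman_le_update n ω hj) _
      _ = R.value (n + 1) ω j x + (I : EReal) := by rw [R.coe_value hb (n + 1) ω hj.le]
    -- Only a finite excess can be moved across the inequality; an infinite one makes the claim
    -- trivial.
    by_cases hIt : I = ⊤
    · rw [hIt]; exact le_top
    · lift I to ℝ≥0 using hIt with I'
      have h2 : V j x ≤ R.value (n + 1) ω j x + (I' : ℝ) := by
        rw [show (((I' : ℝ≥0∞)) : EReal) = ((I' : ℝ) : EReal) from rfl, ← EReal.coe_add] at h1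
        exact_mod_cast h1
      rw [← ENNReal.ofReal_coe_nnreal (p := I')]
      exact ENNReal.ofReal_le_ofReal (by linarith)
  refine (lintegral_mono hpt).trans (le_of_eq ?_)
  -- The old iterate is known at time `j`, before the next noise variable, so the inner integral is
  -- a conditional expectation.
  obtain ⟨T, i1, i2, i3, i4, τ, G, hτ, hG, hc, hgG⟩ :=
    (R.lscFamily hA1 hA2 hb n (j := j + 1) hj).mono (R.past_le_trajectory n j)
  have hval : ∀ ω x, R.value n ω (j + 1) x = (G (τ ω, x)).toReal := fun ω x => by
    rw [← hgG]; rfl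
  simp only [hval]
  exact ((R.controlled n).lintegral_next hA1 hj hτ
    (Φ := fun a => ENNReal.ofReal (V (j + 1) a.2 - (G a).toReal))
    (ENNReal.measurable_ofReal.comp
      (((hb.dp.continuous (j := j + 1) hj).measurable.comp measurable_snd).sub
        (measurable_ereal_toReal.comp hG.measurable)))).symm

/-- Split `V - w n = (V - w (n+1)) + (w (n+1) - w n)` at time `j + 1` and iterate. At the horizon
the updated gap is not positive, since the new hyperplane passes through `(X n N, F (X n N))`. -/
theorem lintegral_gap_le_sum [IsProbabilityMeasure P] (n : ℕ) :
    ∫⁻ ω, ENNReal.ofReal (V 0 (R.X n 0 ω) - R.value (n + 1) ω 0 (R.X n 0 ω)) ∂P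
      ≤ ∑ i ∈ Finset.range S.N, ∫⁻ ω, ENNReal.ofReal (R.value (n + 1) ω (i + 1) (R.X n (i + 1) ω)
          - R.value n ω (i + 1) (R.X n (i + 1) ω)) ∂P := by
  rw [Finset.range_eq_Ico]
  refine Nat.decreasingInduction (motive := fun j _ =>
    ∫⁻ ω, ENNReal.ofReal (V j (R.X n j ω) - R.value (n + 1) ω j (R.X n j ω)) ∂P
      ≤ ∑ i ∈ Finset.Ico j S.N, ∫⁻ ω, ENNReal.ofReal (R.value (n + 1) ω (i + 1) (R.X n (i + 1) ω)
          - R.value n ω (i + 1) (R.X n (i + 1) ω)) ∂P)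
    (fun k hk ih => ?_) ?_ (Nat.zero_le S.N)
  · rw [Finset.sum_eq_sum_Ico_succ_bot hk]
    refine (R.lintegral_gap_step hA1 hA2 hb n hk).trans ?_
    have hm := R.measurable_gap hA1 hA2 hb (n + 1) n (j := k + 1) hk
    have hm' : Measurable[mΩ] fun ω => ENNReal.ofReal
        (V (k + 1) (R.X n (k + 1) ω) - R.value (n + 1) ω (k + 1) (R.X n (k + 1) ω)) :=
      ENNReal.measurable_ofReal.comp hm
    refine le_trans ?_ (add_le_add_right ih _)
    rw [← lintegral_add_right _ hm']
    refine lintegral_mono fun ω => ?_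
    refine le_trans (ENNReal.ofReal_le_ofReal (le_of_eq ?_)) ENNReal.ofReal_add_le
    ring
  · rw [Finset.Ico_self, Finset.sum_empty, nonpos_iff_eq_zero, ← lintegral_zero (μ := P)]
    refine lintegral_congr fun ω => ENNReal.ofReal_of_nonpos ?_
    have h := R.terminal_le_update n ω
    rw [← R.coe_value hb (n + 1) ω le_rfl] at h
    have h' : S.F (R.X n S.N ω) ≤ R.value (n + 1) ω S.N (R.X n S.N ω) := by exact_mod_cast h
    rw [hb.dp.terminal]
    linarith

/-- Dominated convergence: increments vanish pathwise on the ball and are at most `M - c` there,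
with `M` bounding `V j`. -/
theorem tendsto_lintegral_increment_truncated [IsProbabilityMeasure P] {j : ℕ} (hj : j ≤ S.N)
    (r : ℝ) :
    Tendsto (fun n => ∫⁻ ω, ENNReal.ofReal (if ‖R.X n j ω‖ ≤ r then
      R.value (n + 1) ω j (R.X n j ω) - R.value n ω j (R.X n j ω) else 0) ∂P) atTop (𝓝 0) := by
  have hXm : ∀ n, Measurable[mΩ] (R.X n j) := fun n =>
    (R.measurable_state hA1 n hj).mono (R.past_le_ambient _) le_rfl
  obtain ⟨M, hM⟩ := (isCompact_closedBall (0 : Vec d) r).bddAbove_image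
    (hb.dp.continuous hj).continuousOn
  have hlim := tendsto_lintegral_of_dominated_convergence (μ := P)
    (F := fun n ω => ENNReal.ofReal (if ‖R.X n j ω‖ ≤ r then
      R.value (n + 1) ω j (R.X n j ω) - R.value n ω j (R.X n j ω) else 0)) (f := fun _ => 0)
    (fun _ => ENNReal.ofReal (max (M - c) 0)) (fun n => ?_) (fun n => ?_) (by simp) ?_
  · simpa using hlim
  · exact ENNReal.measurable_ofReal.comp (Measurable.ite
      (measurableSet_le (hXm n).norm measurable_const)
      ((R.measurable_value_state hA1 hA2 hb (n + 1) n hj).sub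
        (R.measurable_value_state hA1 hA2 hb n n hj)) measurable_const)
  · refine Eventually.of_forall fun ω => ENNReal.ofReal_le_ofReal ?_
    split_ifs with h
    · have h1 := hM ⟨R.X n j ω, by simpa using h, rfl⟩
      have h2 := R.value_le hb (n + 1) ω hj (R.X n j ω)
      have h3 := R.le_value_real hb n ω hj (R.X n j ω)
      exact le_max_of_le_left (by linarith)
    · exact le_max_right _ _
  · refine Eventually.of_forall fun ω => ?_
    have := tendsto_increment_of_monotone_convexOn
      (fun n => R.convexOn_value hA2 hb n ω hj) (R.monotone_value hb ω hj)
      (fun n x => R.value_le hb n ω hj x) r (fun n => R.X n j ω)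
    simpa using ENNReal.tendsto_ofReal this

theorem tendsto_lintegral_increment [IsProbabilityMeasure P] (hA7 : S.MomentBounds ν P) {j : ℕ}
    (hj : j ≤ S.N) (hj1 : 1 ≤ j) :
    Tendsto (fun n => ∫⁻ ω, ENNReal.ofReal (R.value (n + 1) ω j (R.X n j ω)
      - R.value n ω j (R.X n j ω)) ∂P) atTop (𝓝 0) := by
  -- The moment bounds are applied to the family of all trajectories of the run, giving one exponent
  -- for every `n`.
  obtain ⟨p, hp, -, hmom⟩ := hA7 R.𝓕 R.ξ R.γ R.X R.controlled
  obtain ⟨C, hC⟩ := hb.dp.growth j hj hj1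
  have hC0 : 0 ≤ C := by
    have := (abs_nonneg _).trans (hC 0)
    simpa using this
  -- The constant `D` comes from bounding the increment by `V j - c` and then by `C * (1 + ‖x‖) +
  -- |c|`.
  refine tendsto_lintegral_of_truncation P (Y := fun n ω => ‖R.X n j ω‖) (D := C + |c|) (p := p)
    (fun n => ((R.measurable_state hA1 n hj).mono (R.past_le_ambient _) le_rfl).norm)
    (by positivity) (fun n ω => ?_) hp ?_
    (fun r => R.tendsto_lintegral_increment_truncated hA1 hA2 hb hj r)
  · have h1 := R.value_le hb (n + 1) ω hj (R.X n j ω)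
    have h2 := R.le_value_real hb n ω hj (R.X n j ω)
    have h3 := (le_abs_self _).trans (hC (R.X n j ω))
    have h4 := neg_abs_le c
    have h5 := mul_nonneg (abs_nonneg c) (norm_nonneg (R.X n j ω))
    nlinarith
  · refine lt_of_le_of_lt (iSup_mono fun n => ?_) hmom
    refine le_trans (le_of_eq ?_) (le_iSup₂_of_le j (Finset.mem_Icc.mpr ⟨hj1, hj⟩) le_rfl)
    exact lintegral_congr fun ω => by rw [ofReal_norm]

/-- The expected gap at the initial time vanishes on every ball. -/
theorem tendsto_lintegral_gap_truncated [IsProbabilityMeasure P] (hA7 : S.MomentBounds ν P)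
    (r : ℝ) :
    Tendsto (fun n => ∫⁻ ω, ENNReal.ofReal (if ‖R.X n 0 ω‖ ≤ r then
      V 0 (R.X n 0 ω) - R.value n ω 0 (R.X n 0 ω) else 0) ∂P) atTop (𝓝 0) := by
  have hsum : Tendsto (fun n => ∑ i ∈ Finset.range S.N,
      ∫⁻ ω, ENNReal.ofReal (R.value (n + 1) ω (i + 1) (R.X n (i + 1) ω)
        - R.value n ω (i + 1) (R.X n (i + 1) ω)) ∂P) atTop (𝓝 0) := by
    rw [← Finset.sum_const_zero (s := Finset.range S.N)]
    exact tendsto_finsetSum _ fun i hi => R.tendsto_lintegral_increment hA1 hA2 hb hA7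
      (Finset.mem_range.mp hi) (by omega)
  -- The gap is wanted for `w n`, not `w (n+1)`, so one more increment at time 0 enters. Having
  -- neither growth of `V 0` nor moments of `X n 0`, it is controlled on balls only.
  have htot := hsum.add (R.tendsto_lintegral_increment_truncated hA1 hA2 hb (Nat.zero_le _) r)
  rw [add_zero] at htot
  refine tendsto_of_tendsto_of_tendsto_of_le_of_le tendsto_const_nhds htot
    (fun _ => zero_le) fun n => ?_
  refine le_trans ?_ (add_le_add_left (R.lintegral_gap_le_sum hA1 hA2 hb n) _)
  rw [← lintegral_add_left
    (show Measurable[mΩ] fun ω => ENNReal.ofReal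
      (V 0 (R.X n 0 ω) - R.value (n + 1) ω 0 (R.X n 0 ω)) from
      ENNReal.measurable_ofReal.comp (R.measurable_gap hA1 hA2 hb (n + 1) n (Nat.zero_le _)))]
  refine lintegral_mono fun ω => ?_
  split_ifs
  · refine le_trans (ENNReal.ofReal_le_ofReal (le_of_eq ?_)) ENNReal.ofReal_add_le
    ring
  · simp

/-- By independence of `X n 0` from the past, the expected gap is the expectation of a `ν`-integral.
The infimum over `n` then has expectation zero, and it suffices because the limit dominates every
iterate. -/
theorem ae_iInf_gap_eq_zero [IsProbabilityMeasure P] (hA7 : S.MomentBounds ν P) (r : ℝ) :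
    ∀ᵐ ω ∂P, ⨅ n, ∫⁻ x, ENNReal.ofReal (if ‖x‖ ≤ r then V 0 x - R.value n ω 0 x else 0) ∂ν = 0 := by
  have hstep : ∀ n, Measurable[mΩ] (fun ω => ∫⁻ x, ENNReal.ofReal
        (if ‖x‖ ≤ r then V 0 x - R.value n ω 0 x else 0) ∂ν) ∧
      ∫⁻ ω, ENNReal.ofReal (if ‖R.X n 0 ω‖ ≤ r then
        V 0 (R.X n 0 ω) - R.value n ω 0 (R.X n 0 ω) else 0) ∂P
      = ∫⁻ ω, ∫⁻ x, ENNReal.ofReal (if ‖x‖ ≤ r then V 0 x - R.value n ω 0 x else 0) ∂ν ∂P :=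
    fun n => by
    obtain ⟨T, i1, i2, i3, i4, τ, G, hτ, hG, hc, hgG⟩ :=
      R.lscFamily hA1 hA2 hb n (Nat.zero_le S.N)
    have hval : ∀ ω x, R.value n ω 0 x = (G (τ ω, x)).toReal := fun ω x => by
      rw [← hgG]; rfl
    have hX : Measurable[mΩ] (R.X n 0) :=
      (R.measurable_state hA1 n (Nat.zero_le _)).mono (R.past_le_ambient _) le_rfl
    have hν : P.map (R.X n 0) = ν := (R.controlled n).initial_law
    have : IsProbabilityMeasure ν := hν ▸ Measure.isProbabilityMeasure_map hX.aemeasurable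
    have hΦ : Measurable fun a : T × Vec d => ENNReal.ofReal
        (if ‖a.2‖ ≤ r then V 0 a.2 - (G a).toReal else 0) :=
      ENNReal.measurable_ofReal.comp (Measurable.ite
        (measurableSet_le measurable_snd.norm measurable_const)
        (((hb.dp.continuous (Nat.zero_le _)).measurable.comp measurable_snd).sub
          (measurable_ereal_toReal.comp hG.measurable)) measurable_const)
    simp only [hval]
    refine ⟨hΦ.lintegral_prod_right'.comp (hτ.mono (R.past_le_ambient n) le_rfl), ?_⟩
    have := lintegral_prodMk_of_indep P (R.past_le_ambient n) hτ hX (R.initial_indep n) hΦ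
    rwa [hν] at this
  refine (lintegral_eq_zero_iff (Measurable.iInf fun n => (hstep n).1)).mp ?_
  refine le_antisymm (ge_of_tendsto' (R.tendsto_lintegral_gap_truncated hA1 hA2 hb hA7 r)
    fun n => ?_) (zero_le)
  rw [(hstep n).2]
  exact lintegral_mono fun ω => iInf_le _ n

end Expectation

end AlgorithmRun

end ControlProblem

end

/-! ### Convergence to the value function on the support of the initial law. -/

theorem mainTheorem4 {d d₁ d₂ : ℕ} (S : ControlProblem d d₁ d₂)
    {Ω : Type*} [mΩ : MeasurableSpace Ω] (P : Measure Ω) [IsProbabilityMeasure P]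
    (ν : Measure (Vec d)) [IsProbabilityMeasure ν]
    (hA1 : S.SystemContinuous) (hA2 : S.CostsNonnegLsc) (hA3 : S.TerminalConvex)
    (hA4 : S.ActionsCompact) (hA5 : S.PreservesConvexity) (hA6 : S.ControlsSubgradients)
    (hA7 : S.MomentBounds ν P)
    (w₀ : ℕ → Vec d → EReal) (hw₀ : S.IsSubsolution w₀)
    (hw₀_convex : ∀ j ≤ S.N, ExtConvex (w₀ j))
    (R : S.AlgorithmRun ν P w₀) :
    ∀ᵐ ω ∂P, ∃ (wn : ℕ → Vec d → ℝ) (w : Vec d → ℝ),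
      (∀ n x, R.w n ω 0 x = (wn n x : EReal)) ∧
      (∀ K : Set (Vec d), K ⊆ ν.support → IsCompact K → TendstoUniformlyOn wn w atTop K) ∧
      (∀ x ∈ ν.support, S.valueFunction 0 x = (w x : EReal)) := by
  have : CompactSpace S.Γ := isCompact_iff_compactSpace.mp hA4
  -- `Ω` carries a probability measure, so any control of the run takes some value.
  have : Nonempty S.Γ := (nonempty_of_isProbabilityMeasure P).map (R.γ 0 0)
  obtain ⟨V, hV⟩ := ControlProblem.exists_isDynamicProgram hA2 hA3 hA5 hA6
  obtain ⟨c, hc⟩ := hw₀.bddBelow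
  have hb : S.InitialBounds w₀ V c := ⟨hw₀, hV, hc, hw₀_convex⟩
  have h0 : 0 ≤ S.N := Nat.zero_le _
  -- Integer radii suffice and leave a single null set.
  have hae : ∀ᵐ ω ∂P, ∀ k : ℕ, ⨅ n, ∫⁻ x, ENNReal.ofReal
      (if ‖x‖ ≤ (k : ℝ) then V 0 x - R.value n ω 0 x else 0) ∂ν = 0 :=
    ae_all_iff.mpr fun k => R.ae_iInf_gap_eq_zero hA1 hA2 hb hA7 k
  filter_upwards [hae] with ω hω
  obtain ⟨u, hu, hle, huV, hlim⟩ := exists_limit_of_monotone_convexOn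
    (fun n => R.convexOn_value hA2 hb n ω h0) (R.monotone_value hb ω h0)
    (fun n x => R.value_le hb n ω h0 x)
  refine ⟨fun n x => R.value n ω 0 x, u, fun n x => (R.coe_value hb n ω h0 x).symm,
    fun K _ hK => (tendstoLocallyUniformlyOn_iff_tendstoUniformlyOn_of_compact hK).mp
      hlim.tendstoLocallyUniformlyOn, ?_⟩
  have hVu : ∀ᵐ x ∂ν, V 0 x ≤ u x := by
    have hk : ∀ k : ℕ, ∀ᵐ x ∂ν, ‖x‖ ≤ (k : ℝ) → V 0 x ≤ u x := fun k => by
      have hm : Measurable fun x => ENNReal.ofReal (if ‖x‖ ≤ (k : ℝ) then V 0 x - u x else 0) :=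
        ENNReal.measurable_ofReal.comp (Measurable.ite
          (measurableSet_le measurable_norm measurable_const)
          ((hV.continuous h0).measurable.sub hu.measurable) measurable_const)
      -- The limit `u` lies above every iterate, so this integral is below each term of the
      -- vanishing infimum.
      have hzero : ∫⁻ x, ENNReal.ofReal (if ‖x‖ ≤ (k : ℝ) then V 0 x - u x else 0) ∂ν = 0 := by
        refine le_antisymm ((le_iInf fun n => lintegral_mono fun x => ?_).trans_eq (hω k)) zero_le
        refine ENNReal.ofReal_le_ofReal ?_
        split_ifs
        · have := hle n x
          linarith
        · exact le_rfl
      filter_upwards [(lintegral_eq_zero_iff hm).mp hzero] with x hx hxk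
      have := ENNReal.ofReal_eq_zero.mp hx
      rw [if_pos hxk] at this
      linarith
    filter_upwards [ae_all_iff.mpr hk] with x hx
    obtain ⟨k, hk⟩ := exists_nat_ge ‖x‖
    exact hx k hk
  intro x hx
  -- By continuity `{V 0 ≤ u}` is closed; having full measure, it contains the support.
  have hsupp : ν.support ⊆ {x | V 0 x ≤ u x} :=
    Measure.support_subset_of_isClosed (isClosed_le (hV.continuous h0) hu) hVu
  rw [hV.valueFunction_eq hA1 hA2 x, le_antisymm (hsupp hx) (huV x)]
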